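/- Let $B\in C^1(\mathbb R)$ be Lipschitz continuous, positive, monotonically decreasing and convex, with $B(0)=1$ and $\ln B(-s)-\ln B(s)=s$ for all $s\in\mathbb R$. Let $u:\mathbb R\to\mathbb R$ be smooth with $u''\ge\lambda$ on $\mathbb R$ for some constant $\lambda>0$. For $h>0$ and $i\in\mathbb Z$ put $u_i=u(ih)$ and $$\alpha_i=h^{-2}B(u_{i+1}-u_i),\qquad \beta_i=h^{-2}B(u_{i-1}-u_i),\qquad \pi_i=\frac{e^{-u_i}}{\sum_{j\in\mathbb Z}e^{-u_j}},\qquad \pi^h=(\pi_i)_{i\in\mathbb Z}.$$ For real sequences $f,g$ indexed by $\mathbb Z$ write $\langle f,g\rangle=\sum_{i\in\mathbb Z}f_ig_i$, and let $$(\mathcal L_hf)_i=\alpha_i(f_{i+1}-f_i)-\beta_i(f_i-f_{i-1}),\qquad \Gamma^h(f,g)=\tfrac12\bigl(\mathcal L_h(fg)-f\,\mathcal L_hg-g\,\mathcal L_hf\bigr).$$ Let $P_t$, $t\ge0$, be the semigroup generated by $\mathcal L_h$ on bounded sequences, that is, $(P_tf)_i=\sum_{j\in\mathbb Z}f_j\,p_t(i,j)$,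 where $p_t(i,j)$ are the transition probabilities of the continuous-time Markov chain on $\mathbb Z$ that jumps from $i$ to $i+1$ at rate $\alpha_i$ and from $i$ to $i-1$ at rate $\beta_i$ (the minimal nonnegative solution of the Kolmogorov backward equation with $p_0(i,j)=\delta_{ij}$). Then there is a constant $\theta>0$, depending on $B$ and $u$ but not on $h$, such that for every $h>0$, every bounded $f:\mathbb Z\to\mathbb R$ and every $t\ge0$, $$\Bigl\langle \bigl(P_tf-\langle P_tf,\pi^h\rangle\bigr)^2+\Gamma^h(P_tf,P_tf),\,\pi^h\Bigr\rangle\;\le\;e^{-\theta t}\,\Bigl\langle \bigl(f-\langle f,\pi^h\rangle\bigr)^2+\Gamma^h(f,f),\,\pi^h\Bigr\rangle .$$ Moreover $\sum_{j\in\mathbb Z}e^{-u_j}<\infty$, and the series on both sides of this inequality converge. -/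

import Mathlib

open scoped ENNReal ContDiff

namespace BScheme

noncomputable section

/-- The conditions on the function `B` that defines a `B`-scheme. -/
structure IsSchemeFunction (B : ℝ → ℝ) : Prop where
  contDiff : ContDiff ℝ 1 B
  lipschitz : ∃ K : NNReal, LipschitzWith K B
  map_zero : B 0 = 1
  pos : ∀ s, 0 < B s
  log_sub_log : ∀ s, Real.log (B (-s)) - Real.log (B s) = s
  antitone : Antitone B

/-- The value `u_i = u(x_i)` of the potential at the grid point `x_i = i h`. -/
def gridPotential (u : ℝ → ℝ) (h : ℝ) (i : ℤ) : ℝ := u (i * h)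

/-- The rate `α_i = h⁻² B(u_{i+1} - u_i)` of a jump from `i` to `i + 1`. -/
def rateUp (B u : ℝ → ℝ) (h : ℝ) (i : ℤ) : ℝ :=
  B (gridPotential u h (i + 1) - gridPotential u h i) / h ^ 2

/-- The rate `β_i = h⁻² B(u_{i-1} - u_i)` of a jump from `i` to `i - 1`. -/
def rateDown (B u : ℝ → ℝ) (h : ℝ) (i : ℤ) : ℝ :=
  B (gridPotential u h (i - 1) - gridPotential u h i) / h ^ 2

/-- The weight `exp (-u(x_i))`: the stationary density `π ∝ exp (-u)` of the Fokker-Planck equation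
at the grid point `x_i`, up to a factor that does not depend on `i`. -/
def gibbsWeight (u : ℝ → ℝ) (h : ℝ) (i : ℤ) : ℝ := Real.exp (-gridPotential u h i)

/-- The discrete stationary distribution `π^h`: `π_i = π(x_i) / ∑ⱼ π(x_j)`. -/
def stationary (u : ℝ → ℝ) (h : ℝ) (i : ℤ) : ℝ := gibbsWeight u h i / ∑' j : ℤ, gibbsWeight u h j

/-- The pairing `⟨f, g⟩ = ∑ᵢ f_i g_i`. -/
def pairing (f g : ℤ → ℝ) : ℝ := ∑' i : ℤ, f i * g i

/-- The generator `(L_h q)_i = α_i (q_{i+1} - q_i) - β_i (q_i - q_{i-1})`. -/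
def generator (B u : ℝ → ℝ) (h : ℝ) (q : ℤ → ℝ) (i : ℤ) : ℝ :=
  rateUp B u h i * (q (i + 1) - q i) - rateDown B u h i * (q i - q (i - 1))

/-- The carré du champ operator `Γ^h(f, g) = (L_h(f g) - f L_h g - g L_h f) / 2`. -/
def carreDuChamp (B u : ℝ → ℝ) (h : ℝ) (f g : ℤ → ℝ) (i : ℤ) : ℝ :=
  (generator B u h (fun k => f k * g k) i
    - f i * generator B u h g i - g i * generator B u h f i) / 2

/-- For the continuous-time Markov chain on `ℤ` that jumps from `i` to `i + 1` at rate `a i` and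
from `i` to `i - 1` at rate `b i`: the probability to be at `j` at time `t ≥ 0`, after fewer than
`n` jumps, when started at `i`. The recursion conditions on the time `s` of the first jump. -/
def transitionAux (a b : ℤ → ℝ) : ℕ → ℝ → ℤ → ℤ → ℝ≥0∞
  | 0, _, _, _ => 0
  | n + 1, t, i, j =>
      (if i = j then ENNReal.ofReal (Real.exp (-(a i + b i) * t)) else 0)
        + ∫⁻ s in Set.Icc 0 t, ENNReal.ofReal (Real.exp (-(a i + b i) * s))
            * (ENNReal.ofReal (a i) * transitionAux a b n (t - s) (i + 1) j
              + ENNReal.ofReal (b i) * transitionAux a b n (t - s) (i - 1) j)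

/-- The transition function `p_t(i, j)`, `t ≥ 0`, of the continuous-time Markov chain with jump
rates `a i` (upwards) and `b i` (downwards): the minimal nonnegative solution of the (integrated)
Kolmogorov backward equation, as the increasing limit over the number of jumps. -/
def transition (a b : ℤ → ℝ) (t : ℝ) (i j : ℤ) : ℝ≥0∞ := ⨆ n : ℕ, transitionAux a b n t i j

/-- The semigroup `P_t` generated by `L_h` on bounded sequences: `(P_t f)_i = ∑ⱼ f_j p_t(i, j)`. -/
def semigroup (B u : ℝ → ℝ) (h t : ℝ) (f : ℤ → ℝ) (i : ℤ) : ℝ :=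
  ∑' j : ℤ, f j * (transition (rateUp B u h) (rateDown B u h) t i j).toReal

/-- The sequence `(f - ⟨f, π^h⟩)² + Γ^h(f, f)`. -/
def energyDensity (B u : ℝ → ℝ) (h : ℝ) (f : ℤ → ℝ) (i : ℤ) : ℝ :=
  (f i - pairing f (stationary u h)) ^ 2 + carreDuChamp B u h f f i

end

end BScheme

/-!
Write `w_i = exp (-u_i)`, `g_i = f_{i+1} - f_i`, `m_i = w_i α_i = w_{i+1} β_{i+1}` (detailed
balance), and `V(f) = ∑ w_i (f_i - c)²`, with `c` the `w`-mean of `f`. The chain is reversible, so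
`∑ w_i Γ^h(f, f)_i` is the Dirichlet form `E(f) = ∑ m_i g_i²`, and the claim is the exponential
decay of `V + E` along `P_t f`.

The decay is a discrete Bakry-Émery argument. Along the flow, `V' = -2 E`. The differences `g_i`
evolve by a birth-death chain on the edges, reversible with respect to `m_i`, with the additional
killing rate `κ_i = (α_i - α_{i+1}) + (β_{i+1} - β_i)`. A bound `κ ≤ κ_i` thus gives `E' ≤ -2 κ
E`. Hence `E / κ - V` is nonincreasing; it tends to zero, which is the Poincaré inequality `κ V ≤
E`, and `(V + E)' ≤ -2 κ (V + E)`. So `θ = 2 κ` works.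

The bound on `κ_i` (`exists_curvature_bound`) uses that `B' (0) = -1/2`, by the logarithmic
identity for `B`, so that `B` has slope at most `-1/2` on `(-∞, 0]`, and that the slopes `d_i =
u_{i+1} - u_i` satisfy `d_i ≥ d_{i-1} + lam h²`. The delicate case is that of `d_i` close to zero.
It gives the bound `h⁻² (2 - 2 B(lam h² / 2))`, which is good for bounded `h`; for large `h` it
does not occur.

On the infinite state space, differentiation of `V` and `E` is avoided: the computation is done
for the chain reflected at the ends of `[-N, N]` (`chainMoment_add_chainEnergy_flow_le`), whose
curvature is no smaller because the rates are monotone. The flows of the reflected chains converge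
pointwise to `P_t f` (`tendsto_flow`): `P_t f` solves the backward equation
(`chainSemigroup_backward`), and a maximum principle with the Lyapunov function `1 + i²` compares
the two. The inequality passes to the limit on each finite part of the sum on the left side
(`energy_decay`).
-/

namespace BScheme

open Filter Topology MeasureTheory

/-! ### Scheme functions -/

theorem IsSchemeFunction.map_neg {B : ℝ → ℝ} (hB : IsSchemeFunction B) (s : ℝ) :
    B (-s) = Real.exp s * B s := by
  have h := hB.log_sub_log s
  rw [← Real.exp_log (hB.pos (-s)), ← Real.exp_log (hB.pos s), ← Real.exp_add]
  congr 1
  linarith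

/-- Differentiate `B (-s) = exp s * B s` at `0`. -/
theorem IsSchemeFunction.hasDerivAt_zero {B : ℝ → ℝ} (hB : IsSchemeFunction B) :
    HasDerivAt B (-(1 / 2)) 0 := by
  have hd : HasDerivAt B (deriv B 0) 0 := (hB.contDiff.differentiable one_ne_zero 0).hasDerivAt
  have h1 : HasDerivAt (fun s : ℝ => B (-s)) (-deriv B 0) 0 := by
    have hd' : HasDerivAt B (deriv B 0) (-0) := by simpa using hd
    refine (HasDerivAt.comp (0 : ℝ) hd' (hasDerivAt_neg (0 : ℝ))).congr_deriv ?_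
    simp
  have h2 : HasDerivAt (fun s : ℝ => Real.exp s * B s) (1 + deriv B 0) 0 := by
    refine ((Real.hasDerivAt_exp 0).fun_mul hd).congr_deriv ?_
    simp [hB.map_zero]
  rw [show (fun s : ℝ => B (-s)) = fun s => Real.exp s * B s from funext hB.map_neg] at h1
  have h3 := h1.unique h2
  rwa [show deriv B 0 = -(1 / 2) by linarith] at hd

/-- On `(-∞, 0]`, the slope of the convex function `B` is at most `B' (0) = -1/2`. -/
theorem IsSchemeFunction.half_sub_le {B : ℝ → ℝ} (hB : IsSchemeFunction B)
    (hc : ConvexOn ℝ Set.univ B) {x y : ℝ} (hxy : x ≤ y) (hy : y ≤ 0) :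
    (y - x) / 2 ≤ B x - B y := by
  have hd := hB.hasDerivAt_zero
  have key : ∀ x < (0 : ℝ), slope B x 0 ≤ -(1 / 2) := fun x hx =>
    hc.slope_le_of_hasDerivAt (Set.mem_univ _) (Set.mem_univ _) hx hd
  rcases hxy.eq_or_lt with rfl | hxy
  · simp
  have hs : slope B x y ≤ -(1 / 2) := by
    refine le_trans ?_ (key x (hxy.trans_le hy))
    rcases hy.eq_or_lt with rfl | hy
    · rfl
    · simp only [slope_def_field]
      exact hc.secant_mono (Set.mem_univ x) (Set.mem_univ _) (Set.mem_univ _) hxy.ne'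
        (hxy.trans hy).ne' hy.le
  rw [slope_def_field, div_le_iff₀ (by linarith)] at hs
  linarith

theorem IsSchemeFunction.lt_one {B : ℝ → ℝ} (hB : IsSchemeFunction B) {s : ℝ} (hs : 0 < s) :
    B s < 1 := by
  by_contra hlt
  have h1 : B s = 1 := le_antisymm (hB.map_zero ▸ hB.antitone hs.le) (not_lt.1 hlt)
  have hev : B =ᶠ[nhdsWithin 0 (Set.Ici 0)] fun _ => 1 := by
    filter_upwards [Icc_mem_nhdsGE hs] with x hx
    exact le_antisymm (hB.map_zero ▸ hB.antitone hx.1) (h1 ▸ hB.antitone hx.2)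
  have hd := (hB.hasDerivAt_zero.hasDerivWithinAt (s := Set.Ici 0)).congr_of_eventuallyEq
    hev.symm hB.map_zero.symm
  have := (uniqueDiffWithinAt_Ici (0 : ℝ)).eq_deriv _ hd (hasDerivWithinAt_const _ _ _)
  norm_num at this

/-- Concavity of `1 - B`: this function lies above its chord on `[0, S]`. -/
theorem IsSchemeFunction.mul_le_one_sub {B : ℝ → ℝ} (hB : IsSchemeFunction B)
    (hc : ConvexOn ℝ Set.univ B) {s S : ℝ} (hs : 0 ≤ s) (hS : 0 < S) (hsS : s ≤ S) :
    s * ((1 - B S) / S) ≤ 1 - B s := by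
  have hsub : 0 ≤ 1 - s / S := by rw [sub_nonneg, div_le_one hS]; exact hsS
  have hdiv : 0 ≤ s / S := by positivity
  have h := hc.2 (Set.mem_univ 0) (Set.mem_univ S) hsub hdiv (by ring)
  simp only [smul_eq_mul, mul_zero, zero_add, div_mul_cancel₀ _ hS.ne', hB.map_zero] at h
  have : s * ((1 - B S) / S) = s / S * (1 - B S) := by ring
  rw [this]
  linarith

/-! ### Uniformly convex potentials -/

theorem convexOn_sub_sq {u : ℝ → ℝ} {lam : ℝ} (hu : ContDiff ℝ ∞ u)
    (hconv : ∀ x, lam ≤ deriv (deriv u) x) :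
    ConvexOn ℝ Set.univ (fun x => u x - lam / 2 * x ^ 2) := by
  have hu1 : Differentiable ℝ u := hu.differentiable (by simp)
  have hu2 : Differentiable ℝ (deriv u) := by
    have := (contDiff_infty_iff_deriv.1 hu).2
    exact this.differentiable (by simp)
  have hd : deriv (fun x => u x - lam / 2 * x ^ 2) = fun x => deriv u x - lam * x := by
    funext x
    have := (hu1 x).hasDerivAt.sub (((hasDerivAt_id x).pow 2).const_mul (lam / 2))
    refine (this.congr_deriv ?_).deriv
    simp; ring
  have hd2 : ∀ x, HasDerivAt (fun x => deriv u x - lam * x) (deriv (deriv u) x - lam) x := by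
    intro x
    refine ((hu2 x).hasDerivAt.fun_sub ((hasDerivAt_id x).const_mul lam)).congr_deriv ?_
    simp
  refine convexOn_univ_of_deriv2_nonneg ?_ ?_ ?_
  · fun_prop
  · rw [hd]; exact fun x => (hd2 x).differentiableAt
  · intro x
    simp only [Function.iterate_succ, Function.iterate_zero, Function.comp, id]
    rw [hd, (hd2 x).deriv]
    linarith [hconv x]

theorem tangent_add_sq_le {u : ℝ → ℝ} {lam : ℝ} (hu : ContDiff ℝ ∞ u)
    (hconv : ∀ x, lam ≤ deriv (deriv u) x) (x : ℝ) :
    u 0 + deriv u 0 * x + lam / 2 * x ^ 2 ≤ u x := by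
  have hc := convexOn_sub_sq hu hconv
  have hd : HasDerivAt (fun x => u x - lam / 2 * x ^ 2) (deriv u 0) 0 := by
    have hu1 : Differentiable ℝ u := hu.differentiable (by simp)
    refine ((hu1 0).hasDerivAt.fun_sub
      (((hasDerivAt_id (0 : ℝ)).pow 2).const_mul (lam / 2))).congr_deriv ?_
    simp
  rcases lt_trichotomy x 0 with hx | rfl | hx
  · have := hc.slope_le_of_hasDerivAt (Set.mem_univ _) (Set.mem_univ _) hx hd
    rw [slope_def_field, div_le_iff₀ (by linarith)] at this
    simp at this; linarith
  · simp
  · have := hc.le_slope_of_hasDerivAt (Set.mem_univ _) (Set.mem_univ _) hx hd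
    rw [slope_def_field, le_div_iff₀ (by linarith)] at this
    simp at this; linarith

/-- The increment `u_{i+1} - u_i` of the potential along the edge from `i` to `i + 1`. -/
noncomputable def gridSlope (u : ℝ → ℝ) (h : ℝ) (i : ℤ) : ℝ :=
  gridPotential u h (i + 1) - gridPotential u h i

theorem gridSlope_add_le {u : ℝ → ℝ} {lam : ℝ} (hu : ContDiff ℝ ∞ u)
    (hconv : ∀ x, lam ≤ deriv (deriv u) x) (h : ℝ) (i : ℤ) :
    gridSlope u h (i - 1) + lam * h ^ 2 ≤ gridSlope u h i := by
  have hc := (convexOn_sub_sq hu hconv).2 (Set.mem_univ ((i + 1) * h)) (Set.mem_univ ((i - 1) * h))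
    (by norm_num : (0 : ℝ) ≤ 1 / 2) (by norm_num : (0 : ℝ) ≤ 1 / 2) (by norm_num)
  simp only [smul_eq_mul] at hc
  rw [show 1 / 2 * (((i : ℝ) + 1) * h) + 1 / 2 * ((i - 1) * h) = i * h by ring] at hc
  simp only [gridSlope, gridPotential, sub_add_cancel]
  push_cast
  nlinarith [hc]

theorem gridSlope_monotone {u : ℝ → ℝ} {lam : ℝ} (hu : ContDiff ℝ ∞ u) (hlam : 0 < lam)
    (hconv : ∀ x, lam ≤ deriv (deriv u) x) (h : ℝ) : Monotone (gridSlope u h) := by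
  refine monotone_int_of_le_succ fun i => ?_
  have := gridSlope_add_le hu hconv h (i + 1)
  rw [add_sub_cancel_right] at this
  have : 0 ≤ lam * h ^ 2 := by positivity
  linarith

theorem summable_gibbsWeight {u : ℝ → ℝ} {lam : ℝ} (hu : ContDiff ℝ ∞ u) (hlam : 0 < lam)
    (hconv : ∀ x, lam ≤ deriv (deriv u) x) {h : ℝ} (hh : 0 < h) :
    Summable (gibbsWeight u h) := by
  set D := deriv u 0 with hD
  -- Completing the square: `D x + (lam / 2) x² ≥ |i| - K` for `x = i h`.
  set K : ℝ := (|D| * h + 1) ^ 2 / (2 * lam * h ^ 2) with hK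
  have hb : ∀ i : ℤ, gibbsWeight u h i ≤ Real.exp (K - u 0) * Real.exp (-1) ^ i.natAbs := by
    intro i
    rw [← Real.exp_nat_mul, ← Real.exp_add, gibbsWeight, gridPotential, Real.exp_le_exp]
    have h1 := tangent_add_sq_le hu hconv (i * h)
    rw [Nat.cast_natAbs, Int.cast_abs]
    have h2 : -(|D| * h * |(i : ℝ)|) ≤ D * (i * h) := by
      have := neg_abs_le (D * (i * h))
      rw [abs_mul, abs_mul, abs_of_pos hh] at this
      linarith
    have h3 : (|D| * h + 1) * |(i : ℝ)| ≤ K + lam / 2 * (i * h) ^ 2 := by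
      have h4 : K = (|D| * h + 1) ^ 2 * (2 * lam * h ^ 2)⁻¹ := by rw [hK, div_eq_mul_inv]
      have h5 : (2 * lam * h ^ 2) * (K + lam / 2 * (i * h) ^ 2 - (|D| * h + 1) * |(i : ℝ)|)
          = (|D| * h + 1 - lam * h ^ 2 * |(i : ℝ)|) ^ 2 := by
        have : |(i : ℝ)| ^ 2 = (i : ℝ) ^ 2 := sq_abs _
        rw [h4]
        field_simp
        linear_combination (-(h ^ 4 * lam ^ 2)) * this
      have h6 : 0 < 2 * lam * h ^ 2 := by positivity
      have h7 := sq_nonneg (|D| * h + 1 - lam * h ^ 2 * |(i : ℝ)|)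
      rw [← h5] at h7
      have := nonneg_of_mul_nonneg_right h7 h6
      linarith
    linarith
  refine Summable.of_nonneg_of_le (fun i => (Real.exp_pos _).le) hb (Summable.mul_left _ ?_)
  have hg : Summable fun n : ℕ => Real.exp (-1) ^ n :=
    summable_geometric_of_lt_one (Real.exp_pos _).le (by simp)
  exact Summable.of_nat_of_neg (by simp [hg]) (by simp [hg])

/-! ### Jump rates -/

theorem rateUp_eq (B u : ℝ → ℝ) (h : ℝ) (i : ℤ) : rateUp B u h i = B (gridSlope u h i) / h ^ 2 :=
  rfl

theorem rateDown_eq (B u : ℝ → ℝ) (h : ℝ) (i : ℤ) :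
    rateDown B u h i = B (-gridSlope u h (i - 1)) / h ^ 2 := by
  simp [rateDown, gridSlope]

theorem rateUp_pos {B : ℝ → ℝ} (hB : IsSchemeFunction B) (u : ℝ → ℝ) {h : ℝ} (hh : 0 < h) (i : ℤ) :
    0 < rateUp B u h i := div_pos (hB.pos _) (by positivity)

theorem rateDown_pos {B : ℝ → ℝ} (hB : IsSchemeFunction B) (u : ℝ → ℝ) {h : ℝ} (hh : 0 < h)
    (i : ℤ) : 0 < rateDown B u h i := div_pos (hB.pos _) (by positivity)

theorem gibbsWeight_pos (u : ℝ → ℝ) (h : ℝ) (i : ℤ) : 0 < gibbsWeight u h i := Real.exp_pos _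

theorem detailed_balance {B : ℝ → ℝ} (hB : IsSchemeFunction B) (u : ℝ → ℝ) (h : ℝ) (i : ℤ) :
    gibbsWeight u h i * rateUp B u h i = gibbsWeight u h (i + 1) * rateDown B u h (i + 1) := by
  rw [rateUp_eq, rateDown_eq, add_sub_cancel_right, hB.map_neg]
  have : gibbsWeight u h i = gibbsWeight u h (i + 1) * Real.exp (gridSlope u h i) := by
    rw [gibbsWeight, gibbsWeight, ← Real.exp_add, gridSlope]
    congr 1; ring
  rw [this]; ring

theorem rateUp_antitone {B u : ℝ → ℝ} {lam : ℝ} (hB : IsSchemeFunction B) (hu : ContDiff ℝ ∞ u)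
    (hlam : 0 < lam) (hconv : ∀ x, lam ≤ deriv (deriv u) x) (h : ℝ) :
    Antitone (rateUp B u h) := fun _ _ hij =>
  div_le_div_of_nonneg_right (hB.antitone (gridSlope_monotone hu hlam hconv h hij)) (sq_nonneg h)

theorem rateDown_monotone {B u : ℝ → ℝ} {lam : ℝ} (hB : IsSchemeFunction B) (hu : ContDiff ℝ ∞ u)
    (hlam : 0 < lam) (hconv : ∀ x, lam ≤ deriv (deriv u) x) (h : ℝ) :
    Monotone (rateDown B u h) := fun i j hij => by
  rw [rateDown_eq, rateDown_eq]
  exact div_le_div_of_nonneg_right (hB.antitone (neg_le_neg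
    (gridSlope_monotone hu hlam hconv h (by lia)))) (sq_nonneg h)

/-- The edge weights `w_i α_i = w_{i+1} β_{i+1}` are summable: on each edge, one of the two rates
is a value of `B` on `[0, ∞)` and hence at most `h⁻²`. -/
theorem summable_gibbsWeight_mul_rateUp {B u : ℝ → ℝ} {lam : ℝ} (hB : IsSchemeFunction B)
    (hu : ContDiff ℝ ∞ u) (hlam : 0 < lam) (hconv : ∀ x, lam ≤ deriv (deriv u) x) {h : ℝ}
    (hh : 0 < h) : Summable fun i => gibbsWeight u h i * rateUp B u h i := by
  have hs := summable_gibbsWeight hu hlam hconv hh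
  have hs' : Summable fun i => gibbsWeight u h (i + 1) :=
    (Equiv.addRight (1 : ℤ)).summable_iff.2 hs
  refine Summable.of_nonneg_of_le
    (fun i => (mul_pos (gibbsWeight_pos u h i) (rateUp_pos hB u hh i)).le) (fun i => ?_)
    ((hs.add hs').mul_right (1 / h ^ 2))
  have hB1 : ∀ s, 0 ≤ s → B s / h ^ 2 ≤ 1 / h ^ 2 := fun s hs =>
    div_le_div_of_nonneg_right (hB.map_zero ▸ hB.antitone hs) (sq_nonneg h)
  have w0 := gibbsWeight_pos u h i
  have w1 := gibbsWeight_pos u h (i + 1)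
  have hpos : 0 < 1 / h ^ 2 := by positivity
  rw [add_mul]
  rcases le_total 0 (gridSlope u h i) with hd | hd
  · have := mul_le_mul_of_nonneg_left (hB1 _ hd) w0.le
    rw [rateUp_eq]
    nlinarith
  · rw [detailed_balance hB, rateDown_eq, add_sub_cancel_right]
    have := mul_le_mul_of_nonneg_left (hB1 _ (neg_nonneg.2 hd)) w1.le
    nlinarith

/-! ### The curvature bound -/

/-- If the middle slope stays away from zero, then the bound comes from the slope of `B` on
`(-∞, 0]`, which is at most `-1/2`. -/
theorem IsSchemeFunction.curvature_of_le_abs {B : ℝ → ℝ} (hB : IsSchemeFunction B)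
    (hc : ConvexOn ℝ Set.univ B) {x y z e δ : ℝ} (hxy : x + e ≤ y) (hyz : y + e ≤ z)
    (hδ : 0 ≤ δ) (hδe : δ ≤ e) (hy : δ ≤ |y|) :
    δ / 2 ≤ B y - B z + (B (-y) - B (-x)) := by
  have h1 : B z ≤ B y := hB.antitone (by linarith)
  have h2 : B (-x) ≤ B (-y) := hB.antitone (by linarith)
  rcases le_total 0 y with h0 | h0
  · rw [abs_of_nonneg h0] at hy
    have h3 := hB.half_sub_le hc (x := -y) (y := -(y - δ)) (by linarith) (by linarith)
    have h4 : B (-x) ≤ B (-(y - δ)) := hB.antitone (by linarith)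
    linarith
  · rw [abs_of_nonpos h0] at hy
    have h3 := hB.half_sub_le hc (x := y) (y := y + δ) (by linarith) (by linarith)
    have h4 : B z ≤ B (y + δ) := hB.antitone (by linarith)
    linarith

theorem IsSchemeFunction.curvature_of_abs_le {B : ℝ → ℝ} (hB : IsSchemeFunction B)
    (hc : ConvexOn ℝ Set.univ B) {x y z e S : ℝ} (hxy : x + e ≤ y) (hyz : y + e ≤ z)
    (he : 0 ≤ e) (hS : 0 < S) (heS : e / 2 ≤ S) (hy : |y| ≤ e / 2) :
    e * ((1 - B S) / S) ≤ B y - B z + (B (-y) - B (-x)) := by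
  obtain ⟨hy1, hy2⟩ := abs_le.1 hy
  have h1 : B z ≤ B (e / 2) := hB.antitone (by linarith)
  have h2 : B (-x) ≤ B (e / 2) := hB.antitone (by linarith)
  have h3 := hB.mul_le_one_sub hc (s := e / 2) (by linarith) hS heS
  have h4 := hc.2 (Set.mem_univ y) (Set.mem_univ (-y))
    (by norm_num : (0 : ℝ) ≤ 1 / 2) (by norm_num : (0 : ℝ) ≤ 1 / 2) (by norm_num)
  simp only [smul_eq_mul] at h4
  rw [show 1 / 2 * y + 1 / 2 * -y = 0 by ring, hB.map_zero] at h4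
  have h5 : e * ((1 - B S) / S) = 2 * (e / 2 * ((1 - B S) / S)) := by ring
  rw [h5]
  linarith

/-- A curvature lower bound, uniform in the mesh size. On coarse grids no slope `u_{i+1} - u_i` is
small, as `u 0` is then smaller than the values of `u` at all other grid points by a multiple of
`h²`; on fine grids, `h⁻² (1 - B (lam h² / 2))` is bounded below. -/
theorem exists_curvature_bound {B u : ℝ → ℝ} {lam : ℝ} (hB : IsSchemeFunction B)
    (hc : ConvexOn ℝ Set.univ B) (hu : ContDiff ℝ ∞ u) (hlam : 0 < lam)
    (hconv : ∀ x, lam ≤ deriv (deriv u) x) :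
    ∃ κ : ℝ, 0 < κ ∧ ∀ h : ℝ, 0 < h → ∀ i : ℤ,
      κ ≤ rateUp B u h i - rateUp B u h (i + 1)
        + (rateDown B u h (i + 1) - rateDown B u h i) := by
  set D := deriv u 0 with hD
  set H : ℝ := (4 * |D| + 1) / lam with hH
  have hHpos : 0 < H := by positivity
  set S : ℝ := lam * H ^ 2 / 2 with hS
  have hSpos : 0 < S := by positivity
  have hBS := hB.lt_one hSpos
  have hq : 0 < (1 - B S) / S := div_pos (by linarith) hSpos
  refine ⟨min (lam / 8) (lam * ((1 - B S) / S)), by positivity, fun h hh i => ?_⟩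
  have hh2 : 0 < h ^ 2 := by positivity
  have hxy := gridSlope_add_le hu hconv h i
  have hyz := gridSlope_add_le hu hconv h (i + 1)
  have he : 0 < lam * h ^ 2 := by positivity
  rw [add_sub_cancel_right] at hyz
  have goal_eq : rateUp B u h i - rateUp B u h (i + 1)
        + (rateDown B u h (i + 1) - rateDown B u h i)
      = (B (gridSlope u h i) - B (gridSlope u h (i + 1))
        + (B (-gridSlope u h i) - B (-gridSlope u h (i - 1)))) / h ^ 2 := by
    rw [rateUp_eq, rateUp_eq, rateDown_eq, rateDown_eq, add_sub_cancel_right]; ring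
  rw [goal_eq, le_div_iff₀ hh2]
  have hm1 : min (lam / 8) (lam * ((1 - B S) / S)) * h ^ 2 ≤ lam / 8 * h ^ 2 :=
    mul_le_mul_of_nonneg_right (min_le_left _ _) hh2.le
  have hm2 : min (lam / 8) (lam * ((1 - B S) / S)) * h ^ 2 ≤ lam * ((1 - B S) / S) * h ^ 2 :=
    mul_le_mul_of_nonneg_right (min_le_right _ _) hh2.le
  by_cases hy : lam * h ^ 2 / 4 ≤ |gridSlope u h i|
  · have := hB.curvature_of_le_abs hc hxy hyz (by positivity) (by linarith) hy
    linarith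
  · rw [not_le] at hy
    have hhH : h ≤ H := by
      by_contra hlt
      rw [not_le, hH, div_lt_iff₀ hlam] at hlt
      have hmul : (4 * |D| + 1) * h < h * lam * h := mul_lt_mul_of_pos_right hlt hh
      have hDh := abs_le.1 (le_of_eq (abs_mul D h))
      rw [abs_of_pos hh] at hDh
      rw [abs_lt] at hy
      have t1 := tangent_add_sq_le hu hconv h
      have t2 := tangent_add_sq_le hu hconv (-h)
      have s0 : gridSlope u h 0 = u h - u 0 := by simp [gridSlope, gridPotential]
      have s1 : gridSlope u h (-1) = u 0 - u (-h) := by simp [gridSlope, gridPotential]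
      rcases le_or_gt 0 i with hi | hi
      · have := gridSlope_monotone hu hlam hconv h hi
        nlinarith
      · have := gridSlope_monotone hu hlam hconv h (show i ≤ -1 by lia)
        nlinarith
    have hsq : h ^ 2 ≤ H ^ 2 := by gcongr
    have := hB.curvature_of_abs_le hc hxy hyz he.le hSpos
      (by rw [hS]; gcongr) (by linarith)
    nlinarith

/-! ### A maximum principle -/

/-- A finite family of functions that are negative at time `0` stays negative if a member that
vanishes while no member is positive has to decrease. -/
theorem neg_of_deriv_neg_at_zero {S : Finset ℤ} {z z' : ℤ → ℝ → ℝ}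
    (hcont : ∀ i ∈ S, ContinuousOn (z i) (Set.Ici 0))
    (hderiv : ∀ i ∈ S, ∀ t, 0 < t → z i t = 0 → HasDerivAt (z i) (z' i t) t)
    (h0 : ∀ i ∈ S, z i 0 < 0)
    (hneg : ∀ t, 0 < t → (∀ j ∈ S, z j t ≤ 0) → ∀ i ∈ S, z i t = 0 → z' i t < 0)
    {t : ℝ} (ht : 0 ≤ t) {i : ℤ} (hi : i ∈ S) : z i t < 0 := by
  by_contra hcon
  rw [not_lt] at hcon
  -- `t₀` is the first time at which some member is nonnegative.
  set A : Set ℝ := ⋃ j ∈ S, {s ∈ Set.Icc 0 t | 0 ≤ z j s} with hA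
  have hAclosed : IsClosed A := by
    refine isClosed_biUnion_finset fun j hj => ?_
    exact ((hcont j hj).mono Set.Icc_subset_Ici_self).preimage_isClosed_of_isClosed isClosed_Icc
      isClosed_Ici
  have hAne : A.Nonempty := ⟨t, Set.mem_biUnion hi ⟨⟨ht, le_rfl⟩, hcon⟩⟩
  have hA0 : ∀ s ∈ A, 0 ≤ s := by
    intro s hs
    obtain ⟨j, -, hs, -⟩ := Set.mem_iUnion₂.1 hs
    exact hs.1
  have hAbdd : BddBelow A := ⟨0, hA0⟩
  set t₀ := sInf A with ht₀
  have hmem : t₀ ∈ A := hAclosed.csInf_mem hAne hAbdd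
  obtain ⟨j, hj, ⟨ht0, htt⟩, hzj⟩ := Set.mem_iUnion₂.1 hmem
  have hbefore : ∀ s, 0 ≤ s → s < t₀ → ∀ k ∈ S, z k s < 0 := by
    intro s hs hst k hk
    by_contra hge
    exact (csInf_le hAbdd (Set.mem_biUnion hk ⟨⟨hs, hst.le.trans htt⟩, not_lt.1 hge⟩)).not_gt hst
  have hpos : 0 < t₀ := by
    rcases ht0.eq_or_lt with h | h
    · rw [← h] at hzj
      exact absurd (h0 j hj) (not_lt.2 hzj)
    · exact h
  have hle : ∀ k ∈ S, z k t₀ ≤ 0 := by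
    intro k hk
    have hc : Tendsto (z k) (𝓝[<] t₀) (𝓝 (z k t₀)) :=
      ((hcont k hk).continuousAt (Ici_mem_nhds hpos)).tendsto.mono_left nhdsWithin_le_nhds
    refine le_of_tendsto hc ?_
    filter_upwards [Ioo_mem_nhdsLT hpos] with s hs
    exact (hbefore s hs.1.le hs.2 k hk).le
  have hz0 : z j t₀ = 0 := le_antisymm (hle j hj) hzj
  have hd := hderiv j hj t₀ hpos hz0
  have hdneg := hneg t₀ hpos hle j hj hz0
  have hslope : Tendsto (slope (z j) t₀) (𝓝[<] t₀) (𝓝 (z' j t₀)) :=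
    (hasDerivAt_iff_tendsto_slope.1 hd).mono_left
      (nhdsWithin_mono _ fun x hx => ne_of_lt hx)
  refine hdneg.not_ge (ge_of_tendsto hslope ?_)
  filter_upwards [Ioo_mem_nhdsLT hpos] with s hs
  rw [slope_def_field, hz0]
  exact div_nonneg_of_nonpos (by linarith [hbefore s hs.1.le hs.2 j hj]) (by linarith [hs.2])

/-! ### Birth-death chains on an interval -/

/-- The generator of the birth-death chain on `ℤ` with jump rates `a` (upwards) and `b`
(downwards). -/
def chainGen (a b q : ℤ → ℝ) (i : ℤ) : ℝ := a i * (q (i + 1) - q i) - b i * (q i - q (i - 1))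

theorem exists_linear_flow {E : Type*} [NormedAddCommGroup E] [NormedSpace ℝ E] [CompleteSpace E]
    (A : E →L[ℝ] E) (x : E) :
    ∃ q : ℝ → E, q 0 = x ∧ ∀ t, HasDerivAt q (A (q t)) t := by
  refine ⟨fun t => (NormedSpace.exp (t • A)) x, by simp, fun t => ?_⟩
  exact (ContinuousLinearMap.apply ℝ E x).hasFDerivAt.comp_hasDerivAt t
    (hasDerivAt_exp_smul_const' (𝕂 := ℝ) A t)

/-- For bounded rates, the generator is a bounded operator on bounded sequences, and its exponential
solves the backward equation. -/
theorem exists_chainGen_flow {a b f : ℤ → ℝ} {K C : ℝ} (ha : ∀ i, |a i| ≤ K) (hb : ∀ i, |b i| ≤ K)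
    (hf : ∀ i, |f i| ≤ C) :
    ∃ q : ℝ → ℤ → ℝ, q 0 = f ∧ ∀ t i, HasDerivAt (fun s => q s i) (chainGen a b (q t) i) t := by
  have hK : 0 ≤ K := (abs_nonneg _).trans (ha 0)
  have hbound : ∀ (q : BoundedContinuousFunction ℤ ℝ) (i : ℤ),
      ‖chainGen a b q i‖ ≤ 4 * K * ‖q‖ := by
    intro q i
    have h1 := q.norm_coe_le_norm i
    have h2 := q.norm_coe_le_norm (i + 1)
    have h3 := q.norm_coe_le_norm (i - 1)
    have h4 : ‖a i * (q (i + 1) - q i)‖ ≤ K * (‖q‖ + ‖q‖) := by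
      rw [norm_mul]
      exact mul_le_mul (ha i) ((norm_sub_le _ _).trans (add_le_add h2 h1)) (norm_nonneg _) hK
    have h5 : ‖b i * (q i - q (i - 1))‖ ≤ K * (‖q‖ + ‖q‖) := by
      rw [norm_mul]
      exact mul_le_mul (hb i) ((norm_sub_le _ _).trans (add_le_add h1 h3)) (norm_nonneg _) hK
    refine (norm_sub_le _ _).trans ((add_le_add h4 h5).trans (le_of_eq ?_))
    ring
  let A₀ : BoundedContinuousFunction ℤ ℝ →ₗ[ℝ] BoundedContinuousFunction ℤ ℝ :=
    { toFun := fun q => BoundedContinuousFunction.ofNormedAddCommGroupDiscrete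
        (chainGen a b q) (4 * K * ‖q‖) (hbound q)
      map_add' := fun p q => by
        ext i
        simp [chainGen]
        ring
      map_smul' := fun c q => by
        ext i
        simp [chainGen]
        ring }
  let A : BoundedContinuousFunction ℤ ℝ →L[ℝ] BoundedContinuousFunction ℤ ℝ :=
    A₀.mkContinuous (4 * K) fun q =>
      (BoundedContinuousFunction.norm_le (by positivity)).2 (hbound q)
  let f₀ : BoundedContinuousFunction ℤ ℝ :=
    BoundedContinuousFunction.ofNormedAddCommGroupDiscrete f C hf
  obtain ⟨q, hq0, hq⟩ := exists_linear_flow A f₀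
  refine ⟨fun t => q t, by simp only [hq0]; rfl, fun t i => ?_⟩
  exact (BoundedContinuousFunction.evalCLM ℝ i).hasFDerivAt.comp_hasDerivAt t (hq t)

theorem sum_Icc_sub_telescope (F : ℤ → ℝ) {l r : ℤ} (hlr : l ≤ r) :
    ∑ i ∈ Finset.Icc l r, (F i - F (i - 1)) = F r - F (l - 1) := by
  induction r, hlr using Int.leInduction with
  | base => simp
  | succ n hn ih =>
    rw [← Finset.insert_Icc_right_eq_Icc_add_one (by lia : l ≤ n + 1),
      Finset.sum_insert (by simp), ih]
    simp

/-- The elementary form of Grönwall's inequality. -/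
theorem le_exp_mul_of_deriv_le {F F' : ℝ → ℝ} {k : ℝ}
    (hF : ∀ t, HasDerivAt F (F' t) t) (hk : ∀ t, 0 ≤ t → F' t ≤ -k * F t) {t : ℝ} (ht : 0 ≤ t) :
    F t ≤ Real.exp (-k * t) * F 0 := by
  have hd : ∀ s, HasDerivAt (fun s => Real.exp (k * s) * F s)
      (Real.exp (k * s) * (k * F s + F' s)) s := by
    intro s
    refine ((((hasDerivAt_id s).const_mul k).exp).fun_mul (hF s)).congr_deriv ?_
    simp; ring
  have hanti : AntitoneOn (fun s => Real.exp (k * s) * F s) (Set.Ici 0) := by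
    refine antitoneOn_of_deriv_nonpos (convex_Ici 0)
      (fun s _ => (hd s).continuousAt.continuousWithinAt)
      (fun s _ => (hd s).differentiableAt.differentiableWithinAt) fun s hs => ?_
    rw [interior_Ici] at hs
    rw [(hd s).deriv]
    have := hk s (le_of_lt hs)
    exact mul_nonpos_of_nonneg_of_nonpos (Real.exp_pos _).le (by linarith)
  have h := hanti (Set.self_mem_Ici (a := (0 : ℝ))) ht ht
  simp only [mul_zero, Real.exp_zero, one_mul] at h
  calc F t = Real.exp (-k * t) * (Real.exp (k * t) * F t) := by
        rw [← mul_assoc, ← Real.exp_add]; simp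
    _ ≤ _ := mul_le_mul_of_nonneg_left h (Real.exp_pos _).le

/-- A birth-death chain whose rates vanish at the ends of `[l, r]`, so that it stays in this
interval, reversible with respect to `w`, with curvature at least `κ` on each edge of `[l, r]`. -/
structure IsReflectedChain (a b w : ℤ → ℝ) (l r : ℤ) (κ : ℝ) : Prop where
  le : l ≤ r
  weight_pos : ∀ i, 0 < w i
  balance : ∀ i, w i * a i = w (i + 1) * b (i + 1)
  rate_nonneg : ∀ i, 0 ≤ a i
  rate_pos : ∀ i, l ≤ i → i < r → 0 < a i
  rate_right : a r = 0
  rate_left : a (l - 1) = 0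
  curvature : ∀ i, l ≤ i → i < r → κ ≤ a i - a (i + 1) + (b (i + 1) - b i)

/-- The Dirichlet form of a reversible birth-death chain on `[l, r]`. -/
noncomputable def chainEnergy (a w : ℤ → ℝ) (l r : ℤ) (q : ℤ → ℝ) : ℝ :=
  ∑ i ∈ Finset.Icc l r, w i * a i * (q (i + 1) - q i) ^ 2

/-- The mean of `q` over `[l, r]` with weights `w`. -/
noncomputable def chainMean (w : ℤ → ℝ) (l r : ℤ) (q : ℤ → ℝ) : ℝ :=
  (∑ i ∈ Finset.Icc l r, w i * q i) / ∑ i ∈ Finset.Icc l r, w i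

/-- The second moment of `q - c` over `[l, r]` with respect to the weights `w`. -/
noncomputable def chainMoment (w : ℤ → ℝ) (l r : ℤ) (c : ℝ) (q : ℤ → ℝ) : ℝ :=
  ∑ i ∈ Finset.Icc l r, w i * (q i - c) ^ 2

namespace IsReflectedChain

variable {a b w : ℤ → ℝ} {l r : ℤ} {κ : ℝ}

theorem weight_mul_chainGen (H : IsReflectedChain a b w l r κ) (q : ℤ → ℝ) (i : ℤ) :
    w i * chainGen a b q i
      = w i * a i * (q (i + 1) - q i) - w (i - 1) * a (i - 1) * (q i - q (i - 1)) := by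
  have := H.balance (i - 1)
  rw [sub_add_cancel] at this
  rw [this, chainGen]; ring

theorem sum_mul_chainGen (H : IsReflectedChain a b w l r κ) (φ q : ℤ → ℝ) :
    ∑ i ∈ Finset.Icc l r, w i * (φ i * chainGen a b q i)
      = -∑ i ∈ Finset.Icc l r, w i * a i * ((φ (i + 1) - φ i) * (q (i + 1) - q i)) := by
  have hT := sum_Icc_sub_telescope (fun i => φ (i + 1) * (w i * a i * (q (i + 1) - q i))) H.le
  simp only [H.rate_right, H.rate_left, mul_zero, zero_mul, sub_self] at hT
  rw [eq_neg_iff_add_eq_zero, ← Finset.sum_add_distrib, ← hT]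
  refine Finset.sum_congr rfl fun i _ => ?_
  rw [mul_left_comm, H.weight_mul_chainGen]
  simp only [sub_add_cancel]
  ring

/-- The Bakry-Émery estimate: along the flow, the Dirichlet form decays at rate `2 κ`. The
differences `q_{i+1} - q_i` evolve by a birth-death chain on the edges, reversible with respect to
`w_i a_i`, with an additional decay given by the curvature. -/
theorem sum_mul_chainGen_sub_le (H : IsReflectedChain a b w l r κ) (q : ℤ → ℝ) :
    ∑ i ∈ Finset.Icc l r, w i * a i
        * ((q (i + 1) - q i) * (chainGen a b q (i + 1) - chainGen a b q i))
      ≤ -κ * chainEnergy a w l r q := by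
  have hT := sum_Icc_sub_telescope (fun i => w i * a i * a (i + 1) * (q (i + 2) - q (i + 1))
    * ((q (i + 2) - q (i + 1)) - (q (i + 1) - q i))) H.le
  simp only [H.rate_right, H.rate_left, mul_zero, zero_mul, sub_self] at hT
  rw [chainEnergy, Finset.mul_sum, ← sub_nonpos, ← Finset.sum_sub_distrib, ← hT, ← sub_nonpos,
    ← Finset.sum_sub_distrib]
  refine Finset.sum_nonpos fun i hi => ?_
  obtain ⟨hil, hir⟩ := Finset.mem_Icc.1 hi
  have hbal := H.balance (i - 1)
  rw [sub_add_cancel] at hbal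
  have hm : 0 ≤ w i * a i := mul_nonneg (H.weight_pos i).le (H.rate_nonneg i)
  have hn : 0 ≤ w i * a i * a (i + 1) := mul_nonneg hm (H.rate_nonneg _)
  have hκ : κ * (w i * a i) ≤ (a i - a (i + 1) + (b (i + 1) - b i)) * (w i * a i) := by
    rcases hir.eq_or_lt with rfl | hir
    · simp [H.rate_right]
    · exact mul_le_mul_of_nonneg_right (H.curvature i hil hir) hm
  simp only [sub_add_cancel, chainGen, show i + 1 + 1 = i + 2 by ring, add_sub_cancel_right,
    show i - 1 + 2 = i + 1 by ring]
  rw [hbal]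
  have h1 := mul_nonneg (sub_nonneg.2 hκ) (sq_nonneg (q (i + 1) - q i))
  have h2 := mul_nonneg hn (sq_nonneg ((q (i + 2) - q (i + 1)) - (q (i + 1) - q i)))
  refine le_of_eq_of_le ?_ (neg_nonpos.2 (add_nonneg h1 h2))
  ring

theorem weight_sum_pos (H : IsReflectedChain a b w l r κ) : 0 < ∑ i ∈ Finset.Icc l r, w i :=
  Finset.sum_pos (fun i _ => H.weight_pos i) ⟨l, by simp [H.le]⟩

theorem chainEnergy_nonneg (H : IsReflectedChain a b w l r κ) (q : ℤ → ℝ) :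
    0 ≤ chainEnergy a w l r q :=
  Finset.sum_nonneg fun i _ =>
    mul_nonneg (mul_nonneg (H.weight_pos i).le (H.rate_nonneg i)) (sq_nonneg _)

/-- The mean minimises the second moment. -/
theorem chainMoment_mean_le (H : IsReflectedChain a b w l r κ) (q : ℤ → ℝ) (c : ℝ) :
    chainMoment w l r (chainMean w l r q) q ≤ chainMoment w l r c q := by
  set m := chainMean w l r q with hm
  have hZ := H.weight_sum_pos
  have h1 : ∑ i ∈ Finset.Icc l r, w i * q i = m * ∑ i ∈ Finset.Icc l r, w i := by
    rw [hm, chainMean, div_mul_cancel₀ _ hZ.ne']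
  have h2 : chainMoment w l r c q - chainMoment w l r m q
      = 2 * (m - c) * (∑ i ∈ Finset.Icc l r, w i * q i)
        + (c ^ 2 - m ^ 2) * ∑ i ∈ Finset.Icc l r, w i := by
    simp only [chainMoment, Finset.mul_sum, ← Finset.sum_sub_distrib, ← Finset.sum_add_distrib]
    exact Finset.sum_congr rfl fun i _ => by ring
  rw [h1] at h2
  have h3 : 0 ≤ (m - c) ^ 2 * ∑ i ∈ Finset.Icc l r, w i := mul_nonneg (sq_nonneg _) hZ.le
  linarith

variable {q : ℝ → ℤ → ℝ}

theorem hasDerivAt_chainEnergy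
    (hq : ∀ t i, HasDerivAt (fun s => q s i) (chainGen a b (q t) i) t) (t : ℝ) :
    HasDerivAt (fun s => chainEnergy a w l r (q s))
      (2 * ∑ i ∈ Finset.Icc l r, w i * a i * ((q t (i + 1) - q t i)
        * (chainGen a b (q t) (i + 1) - chainGen a b (q t) i))) t := by
  unfold chainEnergy
  rw [Finset.mul_sum]
  refine HasDerivAt.fun_sum fun i _ => ?_
  refine ((((hq t (i + 1)).fun_sub (hq t i)).fun_pow 2).const_mul (w i * a i)).congr_deriv ?_
  simp; ring

theorem hasDerivAt_chainMoment (H : IsReflectedChain a b w l r κ)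
    (hq : ∀ t i, HasDerivAt (fun s => q s i) (chainGen a b (q t) i) t) (c t : ℝ) :
    HasDerivAt (fun s => chainMoment w l r c (q s)) (-2 * chainEnergy a w l r (q t)) t := by
  have h1 := H.sum_mul_chainGen (fun i => q t i - c) (q t)
  have h2 : -2 * chainEnergy a w l r (q t)
      = ∑ i ∈ Finset.Icc l r, 2 * (w i * ((q t i - c) * chainGen a b (q t) i)) := by
    rw [← Finset.mul_sum, h1, chainEnergy, neg_mul, mul_neg]
    congr 3 with i
    ring
  rw [h2]
  unfold chainMoment
  refine HasDerivAt.fun_sum fun i _ => ?_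
  refine ((((hq t i).sub_const c).fun_pow 2).const_mul (w i)).congr_deriv ?_
  simp; ring

theorem chainMean_flow (H : IsReflectedChain a b w l r κ)
    (hq : ∀ t i, HasDerivAt (fun s => q s i) (chainGen a b (q t) i) t) (t : ℝ) :
    chainMean w l r (q t) = chainMean w l r (q 0) := by
  have hd : ∀ s, HasDerivAt (fun s => ∑ i ∈ Finset.Icc l r, w i * q s i) 0 s := by
    intro s
    have h1 := H.sum_mul_chainGen (fun _ => 1) (q s)
    simp only [one_mul, sub_self, zero_mul, mul_zero, Finset.sum_const_zero, neg_zero] at h1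
    rw [← h1]
    exact HasDerivAt.fun_sum fun i _ => (hq s i).const_mul (w i)
  rw [chainMean, chainMean]
  congr 1
  exact is_const_of_deriv_eq_zero (fun s => (hd s).differentiableAt) (fun s => (hd s).deriv) t 0

theorem chainEnergy_flow_le (H : IsReflectedChain a b w l r κ)
    (hq : ∀ t i, HasDerivAt (fun s => q s i) (chainGen a b (q t) i) t) {t : ℝ} (ht : 0 ≤ t) :
    chainEnergy a w l r (q t) ≤ Real.exp (-(2 * κ) * t) * chainEnergy a w l r (q 0) :=
  le_exp_mul_of_deriv_le (hasDerivAt_chainEnergy hq)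
    (fun s _ => by linarith [H.sum_mul_chainGen_sub_le (q s)]) ht

/-- The flow relaxes to its mean: the Dirichlet form tends to zero, so all differences do. -/
theorem tendsto_chainMoment_flow (H : IsReflectedChain a b w l r κ) (hκ : 0 < κ)
    (hq : ∀ t i, HasDerivAt (fun s => q s i) (chainGen a b (q t) i) t) :
    Tendsto (fun t => chainMoment w l r (chainMean w l r (q 0)) (q t)) atTop (𝓝 0) := by
  have hE : Tendsto (fun t => chainEnergy a w l r (q t)) atTop (𝓝 0) := by
    have hexp : Tendsto (fun t : ℝ => Real.exp (-(2 * κ) * t) * chainEnergy a w l r (q 0))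
        atTop (𝓝 (0 * chainEnergy a w l r (q 0))) := by
      refine Tendsto.mul_const _ (Real.tendsto_exp_atBot.comp ?_)
      exact tendsto_id.const_mul_atTop_of_neg (by linarith)
    rw [zero_mul] at hexp
    refine tendsto_of_tendsto_of_tendsto_of_le_of_le' tendsto_const_nhds hexp
      (Eventually.of_forall fun t => H.chainEnergy_nonneg _) ?_
    filter_upwards [eventually_ge_atTop 0] with t ht using H.chainEnergy_flow_le hq ht
  have hstep : ∀ i, l ≤ i → i < r →
      Tendsto (fun t => q t (i + 1) - q t i) atTop (𝓝 0) := by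
    intro i hl hr
    have hm : 0 < w i * a i := mul_pos (H.weight_pos i) (H.rate_pos i hl hr)
    have hsq : Tendsto (fun t => (q t (i + 1) - q t i) ^ 2) atTop (𝓝 0) := by
      have h0 : Tendsto (fun t => chainEnergy a w l r (q t) / (w i * a i)) atTop (𝓝 0) := by
        simpa using hE.div_const (w i * a i)
      refine squeeze_zero (fun t => sq_nonneg _) (fun t => ?_) h0
      rw [le_div_iff₀ hm, mul_comm]
      exact Finset.single_le_sum (f := fun i => w i * a i * (q t (i + 1) - q t i) ^ 2)
        (fun j _ => mul_nonneg (mul_nonneg (H.weight_pos j).le (H.rate_nonneg j)) (sq_nonneg _))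
        (Finset.mem_Icc.2 ⟨hl, hr.le⟩)
    rw [tendsto_zero_iff_abs_tendsto_zero]
    have := hsq.sqrt
    simpa [Real.sqrt_sq_eq_abs, Function.comp_def] using this
  have hdiff : ∀ i, l ≤ i → i ≤ r → Tendsto (fun t => q t i - q t l) atTop (𝓝 0) := by
    intro i hl
    induction i, hl using Int.leInduction with
    | base => intro _; simp
    | succ n hn ih =>
      intro hr
      have := (hstep n hn (by lia)).add (ih (by lia))
      simpa using this
  set Z := ∑ i ∈ Finset.Icc l r, w i with hZ
  have hZpos : 0 < Z := H.weight_sum_pos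
  have hmean : Tendsto (fun t => q t l - chainMean w l r (q 0)) atTop (𝓝 0) := by
    have h1 : ∀ t, q t l - chainMean w l r (q 0)
        = -((∑ i ∈ Finset.Icc l r, w i * (q t i - q t l)) / Z) := by
      intro t
      rw [← H.chainMean_flow hq t, chainMean, eq_neg_iff_add_eq_zero, sub_add_eq_add_sub,
        add_div' _ _ _ hZpos.ne', ← sub_div, hZ, Finset.mul_sum, ← Finset.sum_add_distrib,
        ← Finset.sum_sub_distrib]
      refine div_eq_zero_iff.2 (Or.inl (Finset.sum_eq_zero fun i _ => ?_))
      ring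
    simp only [h1]
    have h2 : Tendsto (fun t => ∑ i ∈ Finset.Icc l r, w i * (q t i - q t l)) atTop
        (𝓝 (∑ i ∈ Finset.Icc l r, w i * 0)) :=
      tendsto_finsetSum _ fun i hi =>
        (hdiff i (Finset.mem_Icc.1 hi).1 (Finset.mem_Icc.1 hi).2).const_mul _
    simpa using (h2.div_const Z).neg
  have h3 : Tendsto (fun t => chainMoment w l r (chainMean w l r (q 0)) (q t)) atTop
      (𝓝 (∑ i ∈ Finset.Icc l r, w i * (0 + 0) ^ 2)) := by
    refine tendsto_finsetSum _ fun i hi => ?_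
    have h4 := (hdiff i (Finset.mem_Icc.1 hi).1 (Finset.mem_Icc.1 hi).2).add hmean
    refine ((h4.pow 2).const_mul (w i)).congr fun t => ?_
    ring
  simpa using h3

/-- The Poincaré inequality along the flow, obtained by integrating the decay of the Dirichlet form:
`E / κ - V` is nonincreasing in time and tends to zero. -/
theorem poincare_flow (H : IsReflectedChain a b w l r κ) (hκ : 0 < κ)
    (hq : ∀ t i, HasDerivAt (fun s => q s i) (chainGen a b (q t) i) t) (t : ℝ) :
    κ * chainMoment w l r (chainMean w l r (q 0)) (q t) ≤ chainEnergy a w l r (q t) := by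
  set c := chainMean w l r (q 0) with hc
  have hd := fun s => (hasDerivAt_chainEnergy (w := w) (l := l) (r := r) hq s).fun_sub
    ((H.hasDerivAt_chainMoment hq c s).const_mul κ)
  have hanti : Antitone fun s =>
      chainEnergy a w l r (q s) - κ * chainMoment w l r c (q s) := by
    refine antitone_of_deriv_nonpos (fun s => (hd s).differentiableAt) fun s => ?_
    rw [(hd s).deriv]
    linarith [H.sum_mul_chainGen_sub_le (q s)]
  have hlim : Tendsto (fun s => -(κ * chainMoment w l r c (q s))) atTop (𝓝 0) := by
    simpa using ((H.tendsto_chainMoment_flow hκ hq).const_mul κ).neg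
  have h0 : 0 ≤ chainEnergy a w l r (q t) - κ * chainMoment w l r c (q t) := by
    refine le_of_tendsto hlim ?_
    filter_upwards [eventually_ge_atTop t] with s hs
    have := hanti hs
    have := H.chainEnergy_nonneg (q s)
    linarith
  linarith

theorem chainMoment_add_chainEnergy_flow_le (H : IsReflectedChain a b w l r κ) (hκ : 0 < κ)
    (hq : ∀ t i, HasDerivAt (fun s => q s i) (chainGen a b (q t) i) t) {t : ℝ} (ht : 0 ≤ t) :
    chainMoment w l r (chainMean w l r (q 0)) (q t) + chainEnergy a w l r (q t)
      ≤ Real.exp (-(2 * κ) * t) * (chainMoment w l r (chainMean w l r (q 0)) (q 0)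
        + chainEnergy a w l r (q 0)) := by
  refine le_exp_mul_of_deriv_le (fun s => (H.hasDerivAt_chainMoment hq _ s).fun_add
    (hasDerivAt_chainEnergy hq s)) (fun s _ => ?_) ht
  linarith [H.sum_mul_chainGen_sub_le (q s), H.poincare_flow hκ hq s]

end IsReflectedChain

/-! ### The backward equation for the transition function -/

/-- The integral term of the backward equation: the expectation of `g (t - s) k` over the time
`s ≤ t` and the target `k` of the first jump from `i`. -/
noncomputable def firstJump (a b : ℤ → ℝ) (g : ℝ → ℤ → ℝ≥0∞) (t : ℝ) (i : ℤ) : ℝ≥0∞ :=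
  ∫⁻ s in Set.Icc 0 t, ENNReal.ofReal (Real.exp (-(a i + b i) * s))
    * (ENNReal.ofReal (a i) * g (t - s) (i + 1) + ENNReal.ofReal (b i) * g (t - s) (i - 1))

theorem transitionAux_succ (a b : ℤ → ℝ) (n : ℕ) (t : ℝ) (i j : ℤ) :
    transitionAux a b (n + 1) t i j
      = (if i = j then ENNReal.ofReal (Real.exp (-(a i + b i) * t)) else 0)
        + firstJump a b (fun s k => transitionAux a b n s k j) t i := by
  simp only [transitionAux, firstJump]

theorem measurable_jump_integrand (a b : ℤ → ℝ) {g : ℝ → ℤ → ℝ≥0∞}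
    (hg : ∀ i, Measurable fun t => g t i) (i : ℤ) :
    Measurable fun p : ℝ × ℝ => ENNReal.ofReal (Real.exp (-(a i + b i) * p.2))
      * (ENNReal.ofReal (a i) * g (p.1 - p.2) (i + 1)
        + ENNReal.ofReal (b i) * g (p.1 - p.2) (i - 1)) := by
  have hsub : Measurable fun p : ℝ × ℝ => p.1 - p.2 := measurable_fst.sub measurable_snd
  have h1 := (hg (i + 1)).comp hsub
  have h2 := (hg (i - 1)).comp hsub
  have h3 : Measurable fun p : ℝ × ℝ => ENNReal.ofReal (Real.exp (-(a i + b i) * p.2)) := by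
    fun_prop
  exact h3.mul ((h1.const_mul _).add (h2.const_mul _))

theorem measurable_jump_integrand_right (a b : ℤ → ℝ) {g : ℝ → ℤ → ℝ≥0∞}
    (hg : ∀ i, Measurable fun t => g t i) (t : ℝ) (i : ℤ) :
    Measurable fun s : ℝ => ENNReal.ofReal (Real.exp (-(a i + b i) * s))
      * (ENNReal.ofReal (a i) * g (t - s) (i + 1) + ENNReal.ofReal (b i) * g (t - s) (i - 1)) :=
  (measurable_jump_integrand a b hg i).comp measurable_prodMk_left

theorem measurable_firstJump (a b : ℤ → ℝ) {g : ℝ → ℤ → ℝ≥0∞}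
    (hg : ∀ i, Measurable fun t => g t i) (i : ℤ) : Measurable fun t => firstJump a b g t i := by
  have hS : MeasurableSet {p : ℝ × ℝ | 0 ≤ p.2 ∧ p.2 ≤ p.1} :=
    (measurableSet_le measurable_const measurable_snd).inter
      (measurableSet_le measurable_snd measurable_fst)
  have h := ((measurable_jump_integrand a b hg i).indicator hS).lintegral_prod_right'
    (ν := (volume : Measure ℝ))
  convert h using 2 with t
  rw [firstJump, ← lintegral_indicator measurableSet_Icc]
  rfl

theorem measurable_transitionAux (a b : ℤ → ℝ) (n : ℕ) (i j : ℤ) :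
    Measurable fun t => transitionAux a b n t i j := by
  induction n generalizing i with
  | zero => simp only [transitionAux]; exact measurable_const
  | succ n ih =>
    simp only [transitionAux_succ]
    refine Measurable.add ?_ (measurable_firstJump a b ih i)
    split_ifs
    · fun_prop
    · exact measurable_const

theorem firstJump_mono {a b : ℤ → ℝ} {g g' : ℝ → ℤ → ℝ≥0∞} (hg : ∀ t i, g t i ≤ g' t i) (t : ℝ)
    (i : ℤ) : firstJump a b g t i ≤ firstJump a b g' t i :=
  lintegral_mono fun s => by
    dsimp only
    gcongr
    · exact hg _ _
    · exact hg _ _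

theorem transitionAux_mono (a b : ℤ → ℝ) (t : ℝ) (i j : ℤ) :
    Monotone fun n => transitionAux a b n t i j := by
  refine monotone_nat_of_le_succ fun n => ?_
  induction n generalizing t i with
  | zero => simp only [transitionAux]; exact zero_le
  | succ n ih =>
    rw [transitionAux_succ, transitionAux_succ]
    gcongr
    exact firstJump_mono (fun s k => ih s k) t i

theorem measurable_transition (a b : ℤ → ℝ) (i j : ℤ) :
    Measurable fun t => transition a b t i j :=
  Measurable.iSup fun n => measurable_transitionAux a b n i j

theorem transition_eq (a b : ℤ → ℝ) (t : ℝ) (i j : ℤ) :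
    transition a b t i j
      = (if i = j then ENNReal.ofReal (Real.exp (-(a i + b i) * t)) else 0)
        + firstJump a b (fun s k => transition a b s k j) t i := by
  have hJ : firstJump a b (fun s k => transition a b s k j) t i
      = ⨆ n, firstJump a b (fun s k => transitionAux a b n s k j) t i := by
    simp only [firstJump]
    rw [← lintegral_iSup
      (fun n => measurable_jump_integrand_right a b (measurable_transitionAux a b n · j) t i)]
    · congr 1 with s
      rw [← ENNReal.mul_iSup, transition, transition, ENNReal.mul_iSup, ENNReal.mul_iSup,
        ENNReal.iSup_add_iSup_of_monotone]
      · exact fun m n hmn => mul_le_mul_right (transitionAux_mono a b _ _ j hmn) _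
      · exact fun m n hmn => mul_le_mul_right (transitionAux_mono a b _ _ j hmn) _
    · intro m n hmn s
      dsimp only
      gcongr
      · exact transitionAux_mono a b _ _ j hmn
      · exact transitionAux_mono a b _ _ j hmn
  have h1 : transition a b t i j = ⨆ n, transitionAux a b (n + 1) t i j :=
    ((transitionAux_mono a b t i j).iSup_nat_add 1).symm
  rw [h1, hJ, ENNReal.add_iSup]
  simp only [transitionAux_succ]

theorem firstJump_tsum (a b : ℤ → ℝ) {g : ℤ → ℝ → ℤ → ℝ≥0∞}
    (hg : ∀ j i, Measurable fun t => g j t i) (F : ℤ → ℝ≥0∞) (t : ℝ) (i : ℤ) :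
    ∑' j, F j * firstJump a b (g j) t i
      = firstJump a b (fun s k => ∑' j, F j * g j s k) t i := by
  simp only [firstJump]
  have h1 : ∀ j, F j * ∫⁻ s in Set.Icc 0 t, ENNReal.ofReal (Real.exp (-(a i + b i) * s))
        * (ENNReal.ofReal (a i) * g j (t - s) (i + 1) + ENNReal.ofReal (b i) * g j (t - s) (i - 1))
      = ∫⁻ s in Set.Icc 0 t, F j * (ENNReal.ofReal (Real.exp (-(a i + b i) * s))
        * (ENNReal.ofReal (a i) * g j (t - s) (i + 1)
          + ENNReal.ofReal (b i) * g j (t - s) (i - 1))) := fun j =>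
    (lintegral_const_mul _ (measurable_jump_integrand_right a b (hg j) t i)).symm
  simp only [h1]
  rw [← lintegral_tsum fun j =>
    ((measurable_jump_integrand_right a b (hg j) t i).const_mul (F j)).aemeasurable]
  congr 1 with s
  rw [← ENNReal.tsum_mul_left, ← ENNReal.tsum_mul_left, ← ENNReal.tsum_add,
    ← ENNReal.tsum_mul_left]
  congr 1 with j
  ring

/-- The semigroup acting on `[0, ∞]`-valued functions. -/
noncomputable def lsemigroup (a b : ℤ → ℝ) (F : ℤ → ℝ≥0∞) (t : ℝ) (i : ℤ) : ℝ≥0∞ :=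
  ∑' j, F j * transition a b t i j

theorem measurable_lsemigroup (a b : ℤ → ℝ) (F : ℤ → ℝ≥0∞) (i : ℤ) :
    Measurable fun t => lsemigroup a b F t i :=
  Measurable.tsum fun j => (measurable_transition a b i j).const_mul (F j)

theorem tsum_mul_diag (F : ℤ → ℝ≥0∞) (i : ℤ) (x : ℝ≥0∞) :
    ∑' j, F j * (if i = j then x else 0) = F i * x := by
  rw [tsum_eq_single i fun j hj => by simp [hj.symm]]
  simp

theorem lsemigroup_eq (a b : ℤ → ℝ) (F : ℤ → ℝ≥0∞) (t : ℝ) (i : ℤ) :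
    lsemigroup a b F t i = F i * ENNReal.ofReal (Real.exp (-(a i + b i) * t))
      + firstJump a b (lsemigroup a b F) t i := by
  have h := firstJump_tsum a b (g := fun j s k => transition a b s k j)
    (fun j i => measurable_transition a b i j) F t i
  conv_lhs =>
    rw [lsemigroup]
    simp only [transition_eq a b t i]
    simp only [mul_add]
    rw [ENNReal.tsum_add, tsum_mul_diag, h]
  rfl

/-- The first jump happens before time `t` with probability `1 - exp (-(a + b) t)`. -/
theorem exp_add_firstJump_one {a b : ℤ → ℝ} (ha : ∀ i, 0 ≤ a i) (hb : ∀ i, 0 ≤ b i) {t : ℝ}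
    (ht : 0 ≤ t) (i : ℤ) :
    ENNReal.ofReal (Real.exp (-(a i + b i) * t)) + firstJump a b (fun _ _ => 1) t i = 1 := by
  set q := a i + b i with hq
  have hq0 : 0 ≤ q := add_nonneg (ha i) (hb i)
  have h1 : firstJump a b (fun _ _ => 1) t i
      = ∫⁻ s in Set.Icc 0 t, ENNReal.ofReal (Real.exp (-q * s) * q) := by
    simp only [firstJump, mul_one, ← ENNReal.ofReal_add (ha i) (hb i)]
    congr 1 with s
    rw [← ENNReal.ofReal_mul (Real.exp_pos _).le]
  have hd : ∀ s, HasDerivAt (fun s => -Real.exp (-q * s)) (Real.exp (-q * s) * q) s := by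
    intro s
    refine (((hasDerivAt_id s).const_mul (-q)).exp.fun_neg).congr_deriv ?_
    simp
  have hcont : Continuous fun s => Real.exp (-q * s) * q := by fun_prop
  have h2 : ∫ s in Set.Icc 0 t, Real.exp (-q * s) * q = 1 - Real.exp (-q * t) := by
    rw [integral_Icc_eq_integral_Ioc, ← intervalIntegral.integral_of_le ht,
      intervalIntegral.integral_eq_sub_of_hasDerivAt (fun s _ => hd s)
        (hcont.intervalIntegrable _ _)]
    simp; ring
  rw [h1, ← ofReal_integral_eq_lintegral_ofReal hcont.integrableOn_Icc
    (ae_of_all _ fun s => mul_nonneg (Real.exp_pos _).le hq0), h2,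
    ← ENNReal.ofReal_add (Real.exp_pos _).le]
  · simp
  · rw [sub_nonneg, Real.exp_le_one_iff]
    nlinarith

theorem tsum_transitionAux_le {a b : ℤ → ℝ} (ha : ∀ i, 0 ≤ a i) (hb : ∀ i, 0 ≤ b i) (n : ℕ) {t : ℝ}
    (ht : 0 ≤ t) (i : ℤ) : ∑' j, transitionAux a b n t i j ≤ 1 := by
  induction n generalizing t i with
  | zero => simp [transitionAux]
  | succ n ih =>
    have h := firstJump_tsum a b (g := fun j s k => transitionAux a b n s k j)
      (fun j i => measurable_transitionAux a b n i j) (fun _ => 1) t i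
    have hdiag := tsum_mul_diag (fun _ => 1) i (ENNReal.ofReal (Real.exp (-(a i + b i) * t)))
    simp only [one_mul] at h hdiag
    simp only [transitionAux_succ]
    rw [ENNReal.tsum_add, hdiag, h, ← exp_add_firstJump_one ha hb ht i]
    gcongr
    refine setLIntegral_mono' measurableSet_Icc fun s hs => ?_
    have hts : 0 ≤ t - s := by linarith [hs.2]
    gcongr
    · exact ih hts _
    · exact ih hts _

theorem tsum_transition_le {a b : ℤ → ℝ} (ha : ∀ i, 0 ≤ a i) (hb : ∀ i, 0 ≤ b i) {t : ℝ}
    (ht : 0 ≤ t) (i : ℤ) : ∑' j, transition a b t i j ≤ 1 := by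
  rw [ENNReal.tsum_eq_iSup_sum]
  refine iSup_le fun s => ?_
  have h : Tendsto (fun n => ∑ j ∈ s, transitionAux a b n t i j) atTop
      (𝓝 (∑ j ∈ s, transition a b t i j)) :=
    tendsto_finsetSum _ fun j _ => tendsto_atTop_iSup (transitionAux_mono a b t i j)
  exact le_of_tendsto' h fun n =>
    (ENNReal.sum_le_tsum s).trans (tsum_transitionAux_le ha hb n ht i)

/-- A bounded measurable solution of the integrated backward equation solves the backward
equation. -/
theorem backward_of_integral_eq {a b f : ℤ → ℝ} {V : ℝ → ℤ → ℝ} {C : ℝ}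
    (hm : ∀ i, Measurable fun t => V t i) (hC : ∀ t, 0 ≤ t → ∀ i, |V t i| ≤ C)
    (heq : ∀ t, 0 ≤ t → ∀ i, V t i = f i * Real.exp (-(a i + b i) * t)
      + ∫ s in (0 : ℝ)..t, Real.exp (-(a i + b i) * s)
        * (a i * V (t - s) (i + 1) + b i * V (t - s) (i - 1))) (i : ℤ) :
    ContinuousOn (fun t => V t i) (Set.Ici 0)
      ∧ ∀ t, 0 < t → HasDerivAt (fun t => V t i) (chainGen a b (V t) i) t := by
  have hC0 : 0 ≤ C := (abs_nonneg _).trans (hC 0 le_rfl 0)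
  -- `G` is the inflow at `i`, extended to negative times by its value at time `0`.
  set G : ℤ → ℝ → ℝ := fun i r => a i * V (max r 0) (i + 1) + b i * V (max r 0) (i - 1) with hG
  set E : ℤ → ℝ → ℝ := fun i r => Real.exp ((a i + b i) * r) * G i r with hE
  have hGm : ∀ i, Measurable (G i) := fun i =>
    (((hm (i + 1)).comp (measurable_id.max measurable_const)).const_mul _).add
      (((hm (i - 1)).comp (measurable_id.max measurable_const)).const_mul _)
  have hGb : ∀ i r, ‖G i r‖ ≤ (|a i| + |b i|) * C := by
    intro i r
    refine (norm_add_le _ _).trans ?_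
    rw [norm_mul, norm_mul, add_mul]
    exact add_le_add (mul_le_mul_of_nonneg_left (hC _ (le_max_right _ _) _) (norm_nonneg _))
      (mul_le_mul_of_nonneg_left (hC _ (le_max_right _ _) _) (norm_nonneg _))
  have hEint : ∀ i x y, IntervalIntegrable (E i) volume x y := by
    intro i x y
    have hc : Continuous fun r => Real.exp ((a i + b i) * r) := by fun_prop
    have h1 : IntervalIntegrable (G i) volume x y :=
      (intervalIntegrable_const (c := (|a i| + |b i|) * C)).mono_fun
        (hGm i).aestronglyMeasurable (ae_of_all _ fun r => (hGb i r).trans (le_abs_self _))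
    exact h1.continuousOn_mul hc.continuousOn
  set W : ℤ → ℝ → ℝ := fun i t => Real.exp (-(a i + b i) * t) * (f i + ∫ r in (0 : ℝ)..t, E i r)
    with hW
  have hVW : ∀ i t, 0 ≤ t → V t i = W i t := by
    intro i t ht
    have h1 : ∫ s in (0 : ℝ)..t, Real.exp (-(a i + b i) * s)
          * (a i * V (t - s) (i + 1) + b i * V (t - s) (i - 1))
        = ∫ s in (0 : ℝ)..t, Real.exp (-(a i + b i) * t) * E i (t - s) := by
      refine intervalIntegral.integral_congr fun s hs => ?_
      rw [Set.uIcc_of_le ht] at hs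
      have hts : max (t - s) 0 = t - s := max_eq_left (by linarith [hs.2])
      simp only [hE, hG, hts]
      rw [← mul_assoc, ← Real.exp_add]
      congr 2
      ring
    rw [heq t ht, h1, intervalIntegral.integral_const_mul,
      intervalIntegral.integral_comp_sub_left (fun r => E i r), sub_self, sub_zero]
    simp only [hW]
    ring
  have hWcont : ∀ i, Continuous (W i) := fun i => by
    have h1 : Continuous fun t => Real.exp (-(a i + b i) * t) := by fun_prop
    exact h1.mul (continuous_const.add (intervalIntegral.continuous_primitive (hEint i) 0))
  have hGcont : ∀ i, Continuous (G i) := fun i => by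
    have h1 : G i = fun r => a i * W (i + 1) (max r 0) + b i * W (i - 1) (max r 0) := by
      funext r
      simp only [hG, hVW _ _ (le_max_right r 0)]
    have h2 : Continuous fun r : ℝ => max r 0 := by fun_prop
    rw [h1]
    exact (((hWcont _).comp h2).const_mul _).add (((hWcont _).comp h2).const_mul _)
  refine ⟨(hWcont i).continuousOn.congr fun t ht => hVW i t ht, fun t ht => ?_⟩
  have hEcont : Continuous (E i) := by
    have h1 : Continuous fun t => Real.exp ((a i + b i) * t) := by fun_prop
    exact h1.mul (hGcont i)
  have hd : HasDerivAt (W i) (chainGen a b (V t) i) t := by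
    have h1 := ((hasDerivAt_id t).const_mul (-(a i + b i))).exp.fun_mul
      ((intervalIntegral.integral_hasDerivAt_right (hEint i 0 t)
        hEcont.aestronglyMeasurable.stronglyMeasurableAtFilter
        hEcont.continuousAt).const_add (f i))
    refine h1.congr_deriv ?_
    have h2 : Real.exp (-(a i + b i) * t) * E i t = G i t := by
      simp only [hE]
      rw [← mul_assoc, ← Real.exp_add, neg_mul, neg_add_cancel, Real.exp_zero, one_mul]
    have h3 := hVW i t ht.le
    simp only [hW] at h3
    simp only [id, mul_one, h2, chainGen]
    simp only [hG, max_eq_left ht.le]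
    rw [mul_right_comm, ← h3]
    ring
  refine hd.congr_of_eventuallyEq ?_
  filter_upwards [Ioi_mem_nhds ht] with s hs using hVW i s (le_of_lt hs)

theorem summable_transition {a b : ℤ → ℝ} (ha : ∀ i, 0 ≤ a i) (hb : ∀ i, 0 ≤ b i) {t : ℝ}
    (ht : 0 ≤ t) (i : ℤ) : Summable fun j => (transition a b t i j).toReal :=
  ENNReal.summable_toReal ((tsum_transition_le ha hb ht i).trans_lt ENNReal.one_lt_top).ne

theorem transition_ne_top {a b : ℤ → ℝ} (ha : ∀ i, 0 ≤ a i) (hb : ∀ i, 0 ≤ b i) {t : ℝ}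
    (ht : 0 ≤ t) (i j : ℤ) : transition a b t i j ≠ ⊤ :=
  ENNReal.ne_top_of_tsum_ne_top
    ((tsum_transition_le ha hb ht i).trans_lt ENNReal.one_lt_top).ne j

/-- The semigroup of the birth-death chain with rates `a` and `b`, acting on bounded sequences. -/
noncomputable def chainSemigroup (a b f : ℤ → ℝ) (t : ℝ) (i : ℤ) : ℝ :=
  ∑' j : ℤ, f j * (transition a b t i j).toReal

theorem abs_chainSemigroup_le {a b f : ℤ → ℝ} {C : ℝ} (ha : ∀ i, 0 ≤ a i) (hb : ∀ i, 0 ≤ b i)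
    (hf : ∀ i, |f i| ≤ C) {t : ℝ} (ht : 0 ≤ t) (i : ℤ) : |chainSemigroup a b f t i| ≤ C := by
  have hs := (summable_transition ha hb ht i).mul_left C
  have hC : 0 ≤ C := (abs_nonneg _).trans (hf 0)
  have h1 := tsum_of_norm_bounded hs.hasSum
    (f := fun j => f j * (transition a b t i j).toReal) fun j => by
      rw [norm_mul, Real.norm_of_nonneg ENNReal.toReal_nonneg]
      exact mul_le_mul_of_nonneg_right (hf j) ENNReal.toReal_nonneg
  refine h1.trans ?_
  rw [tsum_mul_left, ← ENNReal.tsum_toReal_eq fun j => transition_ne_top ha hb ht i j]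
  have h2 := ENNReal.toReal_mono ENNReal.one_ne_top (tsum_transition_le ha hb ht i)
  rw [ENNReal.toReal_one] at h2
  nlinarith

theorem toReal_lsemigroup {a b f : ℤ → ℝ} (ha : ∀ i, 0 ≤ a i) (hb : ∀ i, 0 ≤ b i)
    (hf0 : ∀ i, 0 ≤ f i) {t : ℝ} (ht : 0 ≤ t) (i : ℤ) :
    (lsemigroup a b (fun j => ENNReal.ofReal (f j)) t i).toReal = chainSemigroup a b f t i := by
  rw [lsemigroup, ENNReal.tsum_toReal_eq fun j =>
    ENNReal.mul_ne_top ENNReal.ofReal_ne_top (transition_ne_top ha hb ht i j), chainSemigroup]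
  congr 1 with j
  rw [ENNReal.toReal_mul, ENNReal.toReal_ofReal (hf0 j)]

theorem lsemigroup_lt_top {a b f : ℤ → ℝ} {C : ℝ} (ha : ∀ i, 0 ≤ a i) (hb : ∀ i, 0 ≤ b i)
    (hf : ∀ i, f i ≤ C) {t : ℝ} (ht : 0 ≤ t) (i : ℤ) :
    lsemigroup a b (fun j => ENNReal.ofReal (f j)) t i < ⊤ := by
  have h : lsemigroup a b (fun j => ENNReal.ofReal (f j)) t i ≤ ENNReal.ofReal C * 1 := by
    refine le_trans ?_ (mul_le_mul_right (tsum_transition_le ha hb ht i) _)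
    rw [← ENNReal.tsum_mul_left]
    exact ENNReal.tsum_le_tsum fun j => mul_le_mul_left (ENNReal.ofReal_le_ofReal (hf j)) _
  exact h.trans_lt (by simp)

theorem chainSemigroup_backward_of_nonneg {a b f : ℤ → ℝ} {C : ℝ} (ha : ∀ i, 0 ≤ a i)
    (hb : ∀ i, 0 ≤ b i) (hf0 : ∀ i, 0 ≤ f i) (hf : ∀ i, f i ≤ C) (i : ℤ) :
    chainSemigroup a b f 0 i = f i
      ∧ ContinuousOn (fun t => chainSemigroup a b f t i) (Set.Ici 0)
      ∧ ∀ t, 0 < t →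
        HasDerivAt (fun t => chainSemigroup a b f t i)
          (chainGen a b (chainSemigroup a b f t) i) t := by
  set F : ℤ → ℝ≥0∞ := fun j => ENNReal.ofReal (f j) with hF
  set V : ℝ → ℤ → ℝ := fun t i => (lsemigroup a b F t i).toReal with hV
  have hVs : ∀ t, 0 ≤ t → ∀ i, V t i = chainSemigroup a b f t i := fun t ht i =>
    toReal_lsemigroup ha hb hf0 ht i
  have hfin : ∀ t, 0 ≤ t → ∀ i, lsemigroup a b F t i < ⊤ := fun t ht i =>
    lsemigroup_lt_top ha hb hf ht i
  have hm : ∀ i, Measurable fun t => V t i := fun i =>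
    (measurable_lsemigroup a b F i).ennreal_toReal
  have hC : ∀ t, 0 ≤ t → ∀ i, |V t i| ≤ C := fun t ht i => by
    rw [hVs t ht]
    exact abs_chainSemigroup_le ha hb (fun i => by rw [abs_of_nonneg (hf0 i)]; exact hf i) ht i
  have heq : ∀ t, 0 ≤ t → ∀ i, V t i = f i * Real.exp (-(a i + b i) * t)
      + ∫ s in (0 : ℝ)..t, Real.exp (-(a i + b i) * s)
        * (a i * V (t - s) (i + 1) + b i * V (t - s) (i - 1)) := by
    intro t ht i
    have h1 := lsemigroup_eq a b F t i
    have hJ : firstJump a b (lsemigroup a b F) t i ≠ ⊤ :=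
      ((le_add_self.trans_eq h1.symm).trans_lt (hfin t ht i)).ne
    have h2 : V t i = f i * Real.exp (-(a i + b i) * t)
        + (firstJump a b (lsemigroup a b F) t i).toReal := by
      simp only [hV]
      rw [h1, ENNReal.toReal_add (ENNReal.mul_ne_top ENNReal.ofReal_ne_top ENNReal.ofReal_ne_top)
        hJ, ENNReal.toReal_mul, ENNReal.toReal_ofReal (hf0 i),
        ENNReal.toReal_ofReal (Real.exp_pos _).le]
    rw [h2, firstJump, intervalIntegral.integral_of_le ht, ← integral_Icc_eq_integral_Ioc]
    congr 1
    rw [← integral_toReal (measurable_jump_integrand_right a b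
      (measurable_lsemigroup a b F) t i).aemeasurable]
    · refine setIntegral_congr_fun measurableSet_Icc fun s hs => ?_
      have hts : 0 ≤ t - s := by linarith [hs.2]
      rw [ENNReal.toReal_mul, ENNReal.toReal_ofReal (Real.exp_pos _).le, ENNReal.toReal_add
        (ENNReal.mul_ne_top ENNReal.ofReal_ne_top (hfin _ hts _).ne)
        (ENNReal.mul_ne_top ENNReal.ofReal_ne_top (hfin _ hts _).ne), ENNReal.toReal_mul,
        ENNReal.toReal_mul, ENNReal.toReal_ofReal (ha i), ENNReal.toReal_ofReal (hb i)]
    · refine (ae_restrict_iff' measurableSet_Icc).2 (ae_of_all _ fun s hs => ?_)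
      have hts : 0 ≤ t - s := by linarith [hs.2]
      exact ENNReal.mul_lt_top ENNReal.ofReal_lt_top (ENNReal.add_lt_top.2
        ⟨ENNReal.mul_lt_top ENNReal.ofReal_lt_top (hfin _ hts _),
          ENNReal.mul_lt_top ENNReal.ofReal_lt_top (hfin _ hts _)⟩)
  obtain ⟨hcont, hder⟩ := backward_of_integral_eq hm hC heq i
  refine ⟨?_, hcont.congr fun t ht => (hVs t ht i).symm, fun t ht => ?_⟩
  · rw [← hVs 0 le_rfl, heq 0 le_rfl]
    simp
  · have h := hder t ht
    rw [show V t = chainSemigroup a b f t from funext (hVs t ht.le)] at h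
    refine h.congr_of_eventuallyEq ?_
    filter_upwards [Ioi_mem_nhds ht] with s hs using (hVs s (le_of_lt hs) i).symm

/-- The semigroup solves the backward equation, with initial value `f`. -/
theorem chainSemigroup_backward {a b f : ℤ → ℝ} {C : ℝ} (ha : ∀ i, 0 ≤ a i) (hb : ∀ i, 0 ≤ b i)
    (hf : ∀ i, |f i| ≤ C) (i : ℤ) :
    chainSemigroup a b f 0 i = f i
      ∧ ContinuousOn (fun t => chainSemigroup a b f t i) (Set.Ici 0)
      ∧ ∀ t, 0 < t →
        HasDerivAt (fun t => chainSemigroup a b f t i)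
          (chainGen a b (chainSemigroup a b f t) i) t := by
  have hC : 0 ≤ C := (abs_nonneg _).trans (hf 0)
  -- The equation is linear: write `f` as the difference of two nonnegative bounded sequences.
  obtain ⟨h0, hc, hd⟩ := chainSemigroup_backward_of_nonneg ha hb
    (f := fun j => f j + C) (C := 2 * C)
    (fun j => by linarith [(abs_le.1 (hf j)).1]) (fun j => by linarith [(abs_le.1 (hf j)).2]) i
  obtain ⟨h0', hc', hd'⟩ := chainSemigroup_backward_of_nonneg ha hb (f := fun _ => C) (C := C)
    (fun _ => hC) (fun _ => le_rfl) i
  have hsub : ∀ t, 0 ≤ t → ∀ k, chainSemigroup a b f t k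
      = chainSemigroup a b (fun j => f j + C) t k - chainSemigroup a b (fun _ => C) t k := by
    intro t ht k
    have hs := summable_transition ha hb ht k
    have hsf : Summable fun j => f j * (transition a b t k j).toReal :=
      Summable.of_norm_bounded (hs.mul_left C) fun j => by
        rw [norm_mul, Real.norm_of_nonneg ENNReal.toReal_nonneg]
        exact mul_le_mul_of_nonneg_right (hf j) ENNReal.toReal_nonneg
    simp only [chainSemigroup, add_mul]
    rw [hsf.tsum_add (hs.mul_left C), add_sub_cancel_right]
  refine ⟨?_, (hc.sub hc').congr fun t ht => hsub t ht i, fun t ht => ?_⟩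
  · rw [hsub 0 le_rfl, h0, h0', add_sub_cancel_right]
  · refine (((hd t ht).fun_sub (hd' t ht)).congr_deriv ?_).congr_of_eventuallyEq ?_
    · rw [chainGen, chainGen, chainGen, hsub t ht.le, hsub t ht.le, hsub t ht.le]
      ring
    · filter_upwards [Ioi_mem_nhds ht] with s hs using hsub s (le_of_lt hs) i

/-! ### Weighted sums over `ℤ` -/

theorem tendsto_sum_Icc_neg {g : ℤ → ℝ} (hg : Summable g) :
    Tendsto (fun N : ℕ => ∑ i ∈ Finset.Icc (-(N : ℤ)) N, g i) atTop (𝓝 (∑' i, g i)) := by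
  exact hg.hasSum.comp (Finset.tendsto_Icc_neg (R := ℤ))

theorem summable_mul_of_bounded {w g : ℤ → ℝ} {C : ℝ} (hw0 : ∀ i, 0 ≤ w i)
    (hw : Summable w) (hg : ∀ i, |g i| ≤ C) : Summable fun i => w i * g i :=
  Summable.of_norm_bounded (hw.mul_right C) fun i => by
    rw [norm_mul, Real.norm_of_nonneg (hw0 i)]
    exact mul_le_mul_of_nonneg_left (hg i) (hw0 i)

theorem abs_sub_sq_le {x y C D : ℝ} (hx : |x| ≤ C) (hy : |y| ≤ D) :
    |(x - y) ^ 2| ≤ (C + D) ^ 2 := by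
  rw [abs_of_nonneg (sq_nonneg _)]
  exact sq_le_sq' (by linarith [(abs_le.1 hx).1, (abs_le.1 hy).2])
    (by linarith [(abs_le.1 hx).2, (abs_le.1 hy).1])

/-- The weighted mean minimises the weighted sum of squared deviations. -/
theorem tsum_sub_mean_sq_le {w g : ℤ → ℝ} {C : ℝ} (hw0 : ∀ i, 0 < w i)
    (hw : Summable w) (hg : ∀ i, |g i| ≤ C) (c : ℝ) :
    ∑' i, w i * (g i - (∑' i, w i * g i) / ∑' i, w i) ^ 2 ≤ ∑' i, w i * (g i - c) ^ 2 := by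
  set Z := ∑' i, w i with hZ
  have hZpos : 0 < Z := hw.tsum_pos (fun i => (hw0 i).le) 0 (hw0 0)
  have hs1 : Summable fun i => w i * g i := summable_mul_of_bounded (fun i => (hw0 i).le) hw hg
  have hs2 : Summable fun i => w i * g i ^ 2 := by
    refine summable_mul_of_bounded (fun i => (hw0 i).le) hw (C := C ^ 2) fun i => ?_
    rw [abs_pow]
    exact pow_le_pow_left₀ (abs_nonneg _) (hg i) 2
  have hexp : ∀ m : ℝ, ∑' i, w i * (g i - m) ^ 2
      = ∑' i, w i * g i ^ 2 + ((-2 * m) * ∑' i, w i * g i + m ^ 2 * Z) := by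
    intro m
    rw [hZ, ← tsum_mul_left, ← tsum_mul_left, ← (hs1.mul_left _).tsum_add (hw.mul_left _),
      ← hs2.tsum_add ((hs1.mul_left _).add (hw.mul_left _))]
    congr 1 with i
    ring
  set m := (∑' i, w i * g i) / Z with hm
  have h1 : ∑' i, w i * g i = m * Z := by rw [hm, div_mul_cancel₀ _ hZpos.ne']
  rw [hexp, hexp, h1]
  nlinarith [mul_nonneg (sq_nonneg (m - c)) hZpos.le]

/-! ### Truncation to finite intervals -/

/-- The flow obeys the maximum principle; the term `δ (1 + t)` makes the inequality at a touching
time strict. -/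
theorem IsReflectedChain.flow_le {a b w : ℤ → ℝ} {l r : ℤ} {κ C : ℝ}
    (H : IsReflectedChain a b w l r κ) {q : ℝ → ℤ → ℝ}
    (hq : ∀ t i, HasDerivAt (fun s => q s i) (chainGen a b (q t) i) t)
    (h0 : ∀ i, q 0 i ≤ C) {t : ℝ} (ht : 0 ≤ t) {i : ℤ} (hi : i ∈ Finset.Icc l r) :
    q t i ≤ C := by
  have hb : ∀ i, 0 ≤ b i := fun i => by
    have h1 := H.balance (i - 1)
    rw [sub_add_cancel] at h1
    exact nonneg_of_mul_nonneg_right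
      (h1 ▸ mul_nonneg (H.weight_pos _).le (H.rate_nonneg _)) (H.weight_pos i)
  have hbl : b l = 0 := by
    have h1 := H.balance (l - 1)
    rw [sub_add_cancel, H.rate_left, mul_zero] at h1
    exact (mul_eq_zero.1 h1.symm).resolve_left (H.weight_pos l).ne'
  refine le_of_forall_pos_le_add fun ε hε => ?_
  have hz : ∀ δ, 0 < δ → q t i - (C + δ * (1 + t)) < 0 := by
    intro δ hδ
    have hd : ∀ i s, HasDerivAt (fun s => q s i - (C + δ * (1 + s)))
        (chainGen a b (q s) i - δ) s := by
      intro i s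
      refine ((hq s i).fun_sub
        ((((hasDerivAt_id s).const_add 1).const_mul δ).const_add C)).congr_deriv ?_
      simp
    refine neg_of_deriv_neg_at_zero (S := Finset.Icc l r)
      (z := fun i s => q s i - (C + δ * (1 + s)))
      (fun i _ s _ => (hd i s).continuousAt.continuousWithinAt)
      (fun i _ s _ _ => hd i s) (fun i _ => by linarith [h0 i]) (fun s hs hle i hi hzi => ?_) ht hi
    obtain ⟨hil, hir⟩ := Finset.mem_Icc.1 hi
    have h1 : a i * (q s (i + 1) - q s i) ≤ 0 := by
      rcases hir.eq_or_lt with rfl | hir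
      · simp [H.rate_right]
      · have := hle (i + 1) (Finset.mem_Icc.2 ⟨by lia, by lia⟩)
        exact mul_nonpos_of_nonneg_of_nonpos (H.rate_nonneg i) (by linarith)
    have h2 : 0 ≤ b i * (q s i - q s (i - 1)) := by
      rcases hil.eq_or_lt with rfl | hil
      · simp [hbl]
      · have := hle (i - 1) (Finset.mem_Icc.2 ⟨by lia, by lia⟩)
        exact mul_nonneg (hb i) (by linarith)
    rw [chainGen]
    linarith
  have h1t : 0 < 1 + t := by linarith
  have := hz (ε / (1 + t)) (by positivity)
  rw [div_mul_cancel₀ _ h1t.ne'] at this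
  linarith

theorem chainGen_neg (a b q : ℤ → ℝ) (i : ℤ) :
    chainGen a b (fun j => -q j) i = -chainGen a b q i := by
  simp only [chainGen]; ring

theorem IsReflectedChain.abs_flow_le {a b w : ℤ → ℝ} {l r : ℤ} {κ C : ℝ}
    (H : IsReflectedChain a b w l r κ) {q : ℝ → ℤ → ℝ}
    (hq : ∀ t i, HasDerivAt (fun s => q s i) (chainGen a b (q t) i) t)
    (h0 : ∀ i, |q 0 i| ≤ C) {t : ℝ} (ht : 0 ≤ t) {i : ℤ} (hi : i ∈ Finset.Icc l r) :
    |q t i| ≤ C := by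
  have h1 := H.flow_le hq (fun i => (abs_le.1 (h0 i)).2) ht hi
  have h2 := H.flow_le (q := fun s i => -q s i)
    (fun s i => by rw [chainGen_neg]; exact (hq s i).fun_neg)
    (fun i => neg_le.1 (abs_le.1 (h0 i)).1) ht hi
  exact abs_le.2 ⟨by linarith, h1⟩

/-- The rates of the chain with rates `a` and `b`, reflected at the ends of `[-N, N]`. -/
noncomputable def cutUp (a : ℤ → ℝ) (N : ℤ) : ℤ → ℝ := (Set.Ico (-N) N).indicator a

/-- See `cutUp`. -/
noncomputable def cutDown (b : ℤ → ℝ) (N : ℤ) : ℤ → ℝ := (Set.Ioc (-N) N).indicator b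

theorem cutUp_of_mem (a : ℤ → ℝ) {N i : ℤ} (h1 : -N ≤ i) (h2 : i < N) : cutUp a N i = a i :=
  Set.indicator_of_mem (Set.mem_Ico.2 ⟨h1, h2⟩) a

theorem cutDown_of_mem (b : ℤ → ℝ) {N i : ℤ} (h1 : -N < i) (h2 : i ≤ N) : cutDown b N i = b i :=
  Set.indicator_of_mem (Set.mem_Ioc.2 ⟨h1, h2⟩) b

/-- A reversible birth-death chain on `ℤ` with monotone rates and curvature at least `κ`. -/
structure IsCurvedChain (a b w : ℤ → ℝ) (κ : ℝ) : Prop where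
  weight_pos : ∀ i, 0 < w i
  balance : ∀ i, w i * a i = w (i + 1) * b (i + 1)
  up_pos : ∀ i, 0 < a i
  down_pos : ∀ i, 0 < b i
  antitone : Antitone a
  monotone : Monotone b
  curvature : ∀ i, κ ≤ a i - a (i + 1) + (b (i + 1) - b i)

namespace IsCurvedChain

variable {a b w : ℤ → ℝ} {κ : ℝ}

/-- Reflection at the ends of an interval lowers `a (i + 1)` and `b i` at the outermost edges, so it
preserves the curvature bound. -/
theorem isReflectedChain (H : IsCurvedChain a b w κ) {N : ℤ} (hN : 0 ≤ N) :
    IsReflectedChain (cutUp a N) (cutDown b N) w (-N) N κ where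
  le := by lia
  weight_pos := H.weight_pos
  balance i := by
    by_cases h : -N ≤ i ∧ i < N
    · rw [cutUp_of_mem a h.1 h.2, cutDown_of_mem b (by lia) (by lia), H.balance]
    · rw [cutUp, cutDown, Set.indicator_of_notMem (by rw [Set.mem_Ico]; lia),
        Set.indicator_of_notMem (by rw [Set.mem_Ioc]; lia), mul_zero, mul_zero]
  rate_nonneg i := Set.indicator_nonneg (fun j _ => (H.up_pos j).le) i
  rate_pos i hl hr := by rw [cutUp_of_mem a hl hr]; exact H.up_pos i
  rate_right := Set.indicator_of_notMem (by simp) a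
  rate_left := Set.indicator_of_notMem (by simp) a
  curvature i hl hr := by
    have h1 : cutUp a N (i + 1) ≤ a (i + 1) :=
      Set.indicator_le_self' (fun j _ => (H.up_pos j).le) _
    have h2 : cutDown b N i ≤ b i := Set.indicator_le_self' (fun j _ => (H.down_pos j).le) _
    rw [cutUp_of_mem a hl hr, cutDown_of_mem b (by lia) (by lia)]
    linarith [H.curvature i]

theorem exists_flow (H : IsCurvedChain a b w κ) {f : ℤ → ℝ} {C : ℝ} (hf : ∀ i, |f i| ≤ C) (N : ℤ) :
    ∃ q : ℝ → ℤ → ℝ, q 0 = f ∧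
      ∀ t i, HasDerivAt (fun s => q s i) (chainGen (cutUp a N) (cutDown b N) (q t) i) t := by
  have ha := H.up_pos (-N)
  have hb := H.down_pos N
  refine exists_chainGen_flow (K := a (-N) + b N) (fun i => ?_) (fun i => ?_) hf
  · by_cases h : i ∈ Set.Ico (-N) N
    · rw [cutUp, Set.indicator_of_mem h, abs_of_pos (H.up_pos i)]
      linarith [H.antitone h.1]
    · rw [cutUp, Set.indicator_of_notMem h, abs_zero]
      linarith
  · by_cases h : i ∈ Set.Ioc (-N) N
    · rw [cutDown, Set.indicator_of_mem h, abs_of_pos (H.down_pos i)]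
      linarith [H.monotone h.2]
    · rw [cutDown, Set.indicator_of_notMem h, abs_zero]
      linarith

/-- `1 + i²` is a Lyapunov function: the drift is bounded towards infinity, as the rates are
monotone. -/
theorem chainGen_sq_le (H : IsCurvedChain a b w κ) (i : ℤ) :
    chainGen a b (fun j => 1 + (j : ℝ) ^ 2) i ≤ 3 * (a 0 + b 0) * (1 + (i : ℝ) ^ 2) := by
  have ha := H.up_pos i
  have hb := H.down_pos i
  have ha0 := H.up_pos 0
  have hb0 := H.down_pos 0
  have h0 : chainGen a b (fun j => 1 + (j : ℝ) ^ 2) i = a i * (2 * i + 1) - b i * (2 * i - 1) := by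
    simp only [chainGen]; push_cast; ring
  rw [h0]
  rcases lt_trichotomy i 0 with hi | rfl | hi
  · have h1 : (i : ℝ) ≤ -1 := by exact_mod_cast (by lia : i ≤ -1)
    have h2 : b i ≤ b 0 := H.monotone hi.le
    have h3 : a i * (2 * i + 1) ≤ 0 := mul_nonpos_of_nonneg_of_nonpos ha.le (by linarith)
    have h4 : b i * (1 - 2 * i) ≤ b 0 * (1 - 2 * i) :=
      mul_le_mul_of_nonneg_right h2 (by linarith)
    have h5 : b 0 * (1 - 2 * i) ≤ b 0 * (3 * (1 + (i : ℝ) ^ 2)) :=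
      mul_le_mul_of_nonneg_left (by nlinarith) hb0.le
    have h6 : 0 ≤ a 0 * (1 + (i : ℝ) ^ 2) := by positivity
    linarith
  · simp; linarith
  · have h1 : (1 : ℝ) ≤ i := by exact_mod_cast (by lia : 1 ≤ i)
    have h2 : a i ≤ a 0 := H.antitone hi.le
    have h3 : 0 ≤ b i * (2 * i - 1) := mul_nonneg hb.le (by linarith)
    have h4 : a i * (2 * i + 1) ≤ a 0 * (2 * i + 1) :=
      mul_le_mul_of_nonneg_right h2 (by linarith)
    have h5 : a 0 * (2 * i + 1) ≤ a 0 * (3 * (1 + (i : ℝ) ^ 2)) :=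
      mul_le_mul_of_nonneg_left (by nlinarith) ha0.le
    have h6 : 0 ≤ b 0 * (1 + (i : ℝ) ^ 2) := by positivity
    linarith

/-- A solution of the backward equation in `(-N, N)` that is nonpositive at time `0` and bounded at
`-N` and `N` is small at a fixed point if `N` is large, by comparison with the multiple of
`(1 + i²) exp (K t)` that exceeds it at `-N` and `N`. -/
theorem le_barrier (H : IsCurvedChain a b w κ) {N : ℤ} {D : ℝ} (hD : 0 < D) {p : ℝ → ℤ → ℝ}
    (hcont : ∀ i ∈ Finset.Icc (-N) N, ContinuousOn (fun t => p t i) (Set.Ici 0))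
    (hderiv : ∀ i, -N < i → i < N → ∀ t, 0 < t →
      HasDerivAt (fun t => p t i) (chainGen a b (p t) i) t)
    (h0 : ∀ i ∈ Finset.Icc (-N) N, p 0 i ≤ 0)
    (hbd : ∀ t, 0 ≤ t → p t (-N) < D ∧ p t N < D) {t : ℝ} (ht : 0 ≤ t) {i : ℤ}
    (hi : i ∈ Finset.Icc (-N) N) :
    p t i ≤ D / (1 + (N : ℝ) ^ 2)
      * ((1 + (i : ℝ) ^ 2) * Real.exp ((3 * (a 0 + b 0) + 1) * t)) := by
  set K := 3 * (a 0 + b 0) + 1 with hK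
  have hK0 : 0 ≤ K := by have := H.up_pos 0; have := H.down_pos 0; linarith
  set A := D / (1 + (N : ℝ) ^ 2) with hA
  have hApos : 0 < A := by positivity
  have hAN : A * (1 + (N : ℝ) ^ 2) = D := div_mul_cancel₀ _ (by positivity)
  have hψ : ∀ i s, HasDerivAt (fun s => A * ((1 + (i : ℝ) ^ 2) * Real.exp (K * s)))
      (A * ((1 + (i : ℝ) ^ 2) * (K * Real.exp (K * s)))) s := by
    intro i s
    refine (((((hasDerivAt_id s).const_mul K).exp).const_mul _).const_mul A).congr_deriv ?_
    simp only [id, mul_one]; ring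
  have hend : ∀ i s, 0 ≤ s → i ∈ Finset.Icc (-N) N → ¬(-N < i ∧ i < N) →
      p s i - A * ((1 + (i : ℝ) ^ 2) * Real.exp (K * s)) < 0 := by
    intro i s hs hi hne
    obtain ⟨h1, h2⟩ := Finset.mem_Icc.1 hi
    have hexp : 1 ≤ Real.exp (K * s) := Real.one_le_exp (by positivity)
    have h3 : (i : ℝ) ^ 2 = (N : ℝ) ^ 2 := by
      rcases (by lia : i = -N ∨ i = N) with rfl | rfl
      · push_cast; ring
      · rfl
    have h4 : p s i < D := by
      rcases (by lia : i = -N ∨ i = N) with rfl | rfl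
      · exact (hbd s hs).1
      · exact (hbd s hs).2
    rw [h3, ← mul_assoc, hAN]
    nlinarith
  refine sub_nonpos.1 (le_of_lt ?_)
  refine neg_of_deriv_neg_at_zero (S := Finset.Icc (-N) N)
    (z := fun i s => p s i - A * ((1 + (i : ℝ) ^ 2) * Real.exp (K * s)))
    (z' := fun i s => chainGen a b (p s) i - A * ((1 + (i : ℝ) ^ 2) * (K * Real.exp (K * s))))
    (fun i hi => (hcont i hi).sub fun s _ => (hψ i s).continuousAt.continuousWithinAt)
    (fun i hi s hs hz => ?_) (fun i hi => ?_) (fun s hs hle i hi hz => ?_) ht hi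
  · by_cases hint : -N < i ∧ i < N
    · exact (hderiv i hint.1 hint.2 s hs).fun_sub (hψ i s)
    · exact absurd hz (hend i s hs.le hi hint).ne
  · have := h0 i hi
    have : 0 < A * ((1 + (i : ℝ) ^ 2) * Real.exp (K * 0)) := by positivity
    linarith
  · by_cases hint : -N < i ∧ i < N
    · have h1 := hle (i + 1) (Finset.mem_Icc.2 ⟨by lia, by lia⟩)
      have h2 := hle (i - 1) (Finset.mem_Icc.2 ⟨by lia, by lia⟩)
      set e := Real.exp (K * s) with he
      have hepos : 0 < e := Real.exp_pos _
      have h3 : chainGen a b (p s) i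
          ≤ A * e * chainGen a b (fun j => 1 + (j : ℝ) ^ 2) i := by
        have e1 := mul_le_mul_of_nonneg_left (show p s (i + 1) - p s i
          ≤ A * ((1 + ((i + 1 : ℤ) : ℝ) ^ 2) * e) - A * ((1 + (i : ℝ) ^ 2) * e) by linarith)
          (H.up_pos i).le
        have e2 := mul_le_mul_of_nonneg_left (show
          A * ((1 + (i : ℝ) ^ 2) * e) - A * ((1 + ((i - 1 : ℤ) : ℝ) ^ 2) * e)
            ≤ p s i - p s (i - 1) by linarith) (H.down_pos i).le
        simp only [chainGen]
        linarith
      have h4 := mul_le_mul_of_nonneg_left (H.chainGen_sq_le i) (mul_pos hApos hepos).le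
      have h5 : 0 < A * e * (1 + (i : ℝ) ^ 2) := by positivity
      have h6 : A * ((1 + (i : ℝ) ^ 2) * (K * e))
          = A * e * (3 * (a 0 + b 0) * (1 + (i : ℝ) ^ 2)) + A * e * (1 + (i : ℝ) ^ 2) := by
        rw [hK]; ring
      linarith
    · exact absurd hz (hend i s hs.le hi hint).ne

/-- The semigroup is the limit of the flows of the chains reflected at the ends of `[-N, N]`. -/
theorem tendsto_flow (H : IsCurvedChain a b w κ) {f : ℤ → ℝ} {C : ℝ} (hf : ∀ i, |f i| ≤ C)
    {q : ℕ → ℝ → ℤ → ℝ} (hq0 : ∀ N, q N 0 = f)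
    (hq : ∀ N t i, HasDerivAt (fun s => q N s i)
      (chainGen (cutUp a N) (cutDown b N) (q N t) i) t) {t : ℝ} (ht : 0 ≤ t) (i : ℤ) :
    Tendsto (fun N => q N t i) atTop (𝓝 (chainSemigroup a b f t i)) := by
  have ha := fun i => (H.up_pos i).le
  have hb := fun i => (H.down_pos i).le
  have hC : 0 ≤ C := (abs_nonneg _).trans (hf 0)
  set v := chainSemigroup a b f with hv
  have hvC : ∀ t, 0 ≤ t → ∀ i, |v t i| ≤ C := fun t ht i => abs_chainSemigroup_le ha hb hf ht i
  have hbw := chainSemigroup_backward ha hb hf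
  have hqC : ∀ (N : ℕ) t, 0 ≤ t → ∀ i ∈ Finset.Icc (-(N : ℤ)) N, |q N t i| ≤ C :=
    fun N t ht i hi => (H.isReflectedChain (by positivity)).abs_flow_le (hq N)
      (fun i => by rw [hq0]; exact hf i) ht hi
  have hqint : ∀ (N : ℕ) i, -(N : ℤ) < i → i < N → ∀ t,
      HasDerivAt (fun s => q N s i) (chainGen a b (q N t) i) t := by
    intro N i h1 h2 t
    have h3 := hq N t i
    rwa [chainGen, cutUp_of_mem a h1.le h2, cutDown_of_mem b h1 h2.le] at h3
  have hqcont : ∀ (N : ℕ) i, ContinuousOn (fun s => q N s i) (Set.Ici 0) := fun N i s _ =>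
    (hq N s i).continuousAt.continuousWithinAt
  have hsub : ∀ (p p' : ℤ → ℝ) i,
      chainGen a b (fun j => p j - p' j) i = chainGen a b p i - chainGen a b p' i := by
    intro p p' i
    simp only [chainGen]; ring
  set L := (1 + (i : ℝ) ^ 2) * Real.exp ((3 * (a 0 + b 0) + 1) * t) with hL
  have hend : ∀ (N : ℕ) t, 0 ≤ t → ∀ i ∈ Finset.Icc (-(N : ℤ)) N,
      v t i - q N t i < 2 * C + 1 ∧ q N t i - v t i < 2 * C + 1 := by
    intro N t ht i hi
    have h1 := abs_le.1 (hvC t ht i)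
    have h2 := abs_le.1 (hqC N t ht i hi)
    constructor <;> linarith
  have hbound : ∀ᶠ N : ℕ in atTop, ‖q N t i - v t i‖ ≤ (2 * C + 1) / (1 + (N : ℝ) ^ 2) * L := by
    filter_upwards [eventually_ge_atTop i.natAbs] with N hN
    have hi : i ∈ Finset.Icc (-(N : ℤ)) N := Finset.mem_Icc.2 ⟨by lia, by lia⟩
    have hl : -(N : ℤ) ∈ Finset.Icc (-(N : ℤ)) N := Finset.mem_Icc.2 ⟨by lia, by lia⟩
    have hr : (N : ℤ) ∈ Finset.Icc (-(N : ℤ)) N := Finset.mem_Icc.2 ⟨by lia, by lia⟩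
    have h1 := H.le_barrier (N := N) (D := 2 * C + 1) (by positivity)
      (p := fun t i => v t i - q N t i)
      (fun i _ => (hbw i).2.1.sub (hqcont N i))
      (fun i h1 h2 t ht => by rw [hsub]; exact ((hbw i).2.2 t ht).fun_sub (hqint N i h1 h2 t))
      (fun i _ => by simp only [hv, (hbw i).1, hq0, sub_self, le_refl])
      (fun t ht => ⟨(hend N t ht _ hl).1, (hend N t ht _ hr).1⟩) ht hi
    have h2 := H.le_barrier (N := N) (D := 2 * C + 1) (by positivity)
      (p := fun t i => q N t i - v t i)
      (fun i _ => (hqcont N i).sub (hbw i).2.1)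
      (fun i h1 h2 t ht => by rw [hsub]; exact (hqint N i h1 h2 t).fun_sub ((hbw i).2.2 t ht))
      (fun i _ => by simp only [hv, (hbw i).1, hq0, sub_self, le_refl])
      (fun t ht => ⟨(hend N t ht _ hl).2, (hend N t ht _ hr).2⟩) ht hi
    rw [Int.cast_natCast] at h1 h2
    rw [Real.norm_eq_abs, abs_le]
    constructor <;> linarith
  have hlim : Tendsto (fun N : ℕ => (2 * C + 1) / (1 + (N : ℝ) ^ 2) * L) atTop (𝓝 0) := by
    have h1 : Tendsto (fun N : ℕ => 1 + (N : ℝ) ^ 2) atTop atTop :=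
      tendsto_atTop_add_const_left _ _
        ((tendsto_pow_atTop two_ne_zero).comp tendsto_natCast_atTop_atTop)
    simpa using (h1.const_div_atTop (2 * C + 1)).mul_const L
  exact tendsto_sub_nhds_zero_iff.1 (squeeze_zero_norm' hbound hlim)

/-- The decay of the energy for the chain on `ℤ`: pass to the limit in the inequality for the
reflected chains on each finite part of the sum on the left side. -/
theorem energy_decay (H : IsCurvedChain a b w κ) (hκ : 0 < κ) (hw : Summable w)
    (hwa : Summable fun i => w i * a i) {f : ℤ → ℝ} {C : ℝ} (hf : ∀ i, |f i| ≤ C) {t : ℝ}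
    (ht : 0 ≤ t) {c : ℝ} (hc : c = (∑' i, w i * f i) / ∑' i, w i) :
    ∑' i, (w i * (chainSemigroup a b f t i - c) ^ 2
        + w i * a i * (chainSemigroup a b f t (i + 1) - chainSemigroup a b f t i) ^ 2)
      ≤ Real.exp (-(2 * κ) * t)
        * ∑' i, (w i * (f i - c) ^ 2 + w i * a i * (f (i + 1) - f i) ^ 2) := by
  have ha := fun i => (H.up_pos i).le
  have hb := fun i => (H.down_pos i).le
  have hw0 := fun i => (H.weight_pos i).le
  have hwa0 : ∀ i, 0 ≤ w i * a i := fun i => mul_nonneg (hw0 i) (ha i)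
  set v := chainSemigroup a b f t with hv
  have hvC : ∀ i, |v i| ≤ C := fun i => abs_chainSemigroup_le ha hb hf ht i
  have hsum : ∀ g : ℤ → ℝ, (∀ i, |g i| ≤ C) →
      Summable fun i => w i * (g i - c) ^ 2 + w i * a i * (g (i + 1) - g i) ^ 2 := fun g hg =>
    (summable_mul_of_bounded hw0 hw fun i => abs_sub_sq_le (hg i) le_rfl).add
      (summable_mul_of_bounded hwa0 hwa fun i => abs_sub_sq_le (hg (i + 1)) (hg i))
  have hterm : ∀ (g : ℤ → ℝ) i, 0 ≤ w i * (g i - c) ^ 2 + w i * a i * (g (i + 1) - g i) ^ 2 :=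
    fun g i => add_nonneg (mul_nonneg (hw0 i) (sq_nonneg _)) (mul_nonneg (hwa0 i) (sq_nonneg _))
  choose q hq0 hq using fun N : ℕ => H.exists_flow hf N
  have hqlim := fun i => H.tendsto_flow hf hq0 hq ht i
  have hclim : Tendsto (fun N : ℕ => chainMean w (-N) N f) atTop (𝓝 c) := by
    rw [hc]
    exact (tendsto_sum_Icc_neg (summable_mul_of_bounded hw0 hw hf)).div (tendsto_sum_Icc_neg hw)
      (hw.tsum_pos hw0 0 (H.weight_pos 0)).ne'
  refine (hsum v hvC).tsum_le_of_sum_le fun s => ?_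
  have hlim : Tendsto (fun N : ℕ => ∑ i ∈ s, (w i * (q N t i - chainMean w (-N) N f) ^ 2
      + w i * a i * (q N t (i + 1) - q N t i) ^ 2)) atTop
      (𝓝 (∑ i ∈ s, (w i * (v i - c) ^ 2 + w i * a i * (v (i + 1) - v i) ^ 2))) :=
    tendsto_finsetSum _ fun i _ => ((((hqlim i).sub hclim).pow 2).const_mul _).add
      ((((hqlim (i + 1)).sub (hqlim i)).pow 2).const_mul _)
  have hs : ∀ᶠ N : ℕ in atTop, ∀ i ∈ s, i.natAbs < N :=
    (Filter.eventually_all_finset s).2 fun i _ => eventually_gt_atTop _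
  refine le_of_tendsto hlim ?_
  filter_upwards [hs] with N hN
  have HN := H.isReflectedChain (N := N) (by positivity)
  have hle : ∀ i, cutUp a N i ≤ a i := fun i => Set.indicator_le_self' (fun j _ => ha j) i
  have hdecay := HN.chainMoment_add_chainEnergy_flow_le hκ (hq N) ht
  rw [hq0] at hdecay
  calc ∑ i ∈ s, (w i * (q N t i - chainMean w (-N) N f) ^ 2
      + w i * a i * (q N t (i + 1) - q N t i) ^ 2)
      = ∑ i ∈ s, (w i * (q N t i - chainMean w (-N) N f) ^ 2
        + w i * cutUp a N i * (q N t (i + 1) - q N t i) ^ 2) :=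
        Finset.sum_congr rfl fun i hi => by
          have := hN i hi
          rw [cutUp_of_mem a (by lia) (by lia)]
    _ ≤ ∑ i ∈ Finset.Icc (-(N : ℤ)) N, (w i * (q N t i - chainMean w (-N) N f) ^ 2
        + w i * cutUp a N i * (q N t (i + 1) - q N t i) ^ 2) := by
        refine Finset.sum_le_sum_of_subset_of_nonneg (fun i hi => ?_) fun i _ _ => ?_
        · have := hN i hi
          exact Finset.mem_Icc.2 ⟨by lia, by lia⟩
        · exact add_nonneg (mul_nonneg (hw0 i) (sq_nonneg _))
            (mul_nonneg (mul_nonneg (hw0 i) (HN.rate_nonneg i)) (sq_nonneg _))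
    _ = chainMoment w (-N) N (chainMean w (-N) N f) (q N t)
        + chainEnergy (cutUp a N) w (-N) N (q N t) := Finset.sum_add_distrib
    _ ≤ _ := hdecay
    _ ≤ Real.exp (-(2 * κ) * t) * (chainMoment w (-N) N c f
        + chainEnergy (cutUp a N) w (-N) N f) := by
        gcongr
        exact HN.chainMoment_mean_le f c
    _ ≤ _ := by
        gcongr
        rw [chainMoment, chainEnergy, ← Finset.sum_add_distrib]
        refine (Finset.sum_le_sum fun i _ => ?_).trans
          ((hsum f hf).sum_le_tsum _ fun i _ => hterm f i)
        gcongr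
        · exact hw0 i
        · exact hle i

end IsCurvedChain

/-! ### The energy of a `B`-scheme -/

theorem carreDuChamp_self (B u : ℝ → ℝ) (h : ℝ) (g : ℤ → ℝ) (i : ℤ) :
    carreDuChamp B u h g g i = (rateUp B u h i * (g (i + 1) - g i) ^ 2
      + rateDown B u h i * (g i - g (i - 1)) ^ 2) / 2 := by
  simp only [carreDuChamp, generator]; ring

theorem pairing_stationary (u : ℝ → ℝ) (h : ℝ) (g : ℤ → ℝ) :
    pairing g (stationary u h)
      = (∑' i, gibbsWeight u h i * g i) / ∑' i, gibbsWeight u h i := by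
  rw [pairing, ← tsum_div_const]
  congr 1 with i
  rw [stationary]; ring

/-- By detailed balance, `⟨Γ^h(g, g), π^h⟩` is the Dirichlet form, a sum over the edges: each edge
contributes one half of its energy to each of its end points. -/
theorem hasSum_energyDensity {B u : ℝ → ℝ} {h : ℝ} (hB : IsSchemeFunction B) (hh : 0 < h)
    (hw : Summable (gibbsWeight u h)) (hwa : Summable fun i => gibbsWeight u h i * rateUp B u h i)
    {g : ℤ → ℝ} {C : ℝ} (hg : ∀ i, |g i| ≤ C) :
    HasSum (fun i => energyDensity B u h g i * stationary u h i)
      ((∑' i, gibbsWeight u h i * (g i - pairing g (stationary u h)) ^ 2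
        + ∑' i, gibbsWeight u h i * rateUp B u h i * (g (i + 1) - g i) ^ 2)
        / ∑' i, gibbsWeight u h i) := by
  set c := pairing g (stationary u h) with hc
  set e : ℤ → ℝ := fun i => gibbsWeight u h i * rateUp B u h i * (g (i + 1) - g i) ^ 2 with he
  have hv : Summable fun i => gibbsWeight u h i * (g i - c) ^ 2 :=
    summable_mul_of_bounded (fun i => (gibbsWeight_pos u h i).le) hw
      fun i => abs_sub_sq_le (hg i) le_rfl
  have hes : HasSum e (∑' i, e i) := (summable_mul_of_bounded
    (fun i => (mul_pos (gibbsWeight_pos u h i) (rateUp_pos hB u hh i)).le) hwa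
      fun i => abs_sub_sq_le (hg (i + 1)) (hg i)).hasSum
  have hes' : HasSum (fun i => e (i - 1)) (∑' i, e i) := (Equiv.subRight (1 : ℤ)).hasSum_iff.2 hes
  have hsum := (hv.hasSum.add ((hes.add hes').div_const 2)).div_const (∑' i, gibbsWeight u h i)
  rw [add_self_div_two] at hsum
  refine hsum.congr_fun fun i => ?_
  have hb := detailed_balance hB u h (i - 1)
  rw [sub_add_cancel] at hb
  rw [energyDensity, ← hc, carreDuChamp_self, stationary]
  simp only [he, sub_add_cancel]
  rw [hb]
  ring

theorem isCurvedChain {B u : ℝ → ℝ} {lam κ h : ℝ} (hB : IsSchemeFunction B) (hu : ContDiff ℝ ∞ u)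
    (hlam : 0 < lam) (hconv : ∀ x, lam ≤ deriv (deriv u) x) (hh : 0 < h)
    (hκ : ∀ i, κ ≤ rateUp B u h i - rateUp B u h (i + 1)
      + (rateDown B u h (i + 1) - rateDown B u h i)) :
    IsCurvedChain (rateUp B u h) (rateDown B u h) (gibbsWeight u h) κ where
  weight_pos := gibbsWeight_pos u h
  balance := detailed_balance hB u h
  up_pos := rateUp_pos hB u hh
  down_pos := rateDown_pos hB u hh
  antitone := rateUp_antitone hB hu hlam hconv h
  monotone := rateDown_monotone hB hu hlam hconv h
  curvature := hκ

end BScheme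

theorem corollary1p1 (B u : ℝ → ℝ) (lam : ℝ)
    (hB : BScheme.IsSchemeFunction B) (hBconv : ConvexOn ℝ Set.univ B)
    (hu : ContDiff ℝ ∞ u) (hlam : 0 < lam) (hconv : ∀ x : ℝ, lam ≤ deriv (deriv u) x) :
    ∃ θ : ℝ, 0 < θ ∧ ∀ h : ℝ, 0 < h →
      Summable (BScheme.gibbsWeight u h) ∧
      ∀ f : ℤ → ℝ, (∃ C : ℝ, ∀ i : ℤ, |f i| ≤ C) →
        Summable (fun i => BScheme.energyDensity B u h f i * BScheme.stationary u h i) ∧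
        ∀ t : ℝ, 0 ≤ t →
          Summable (fun i => BScheme.energyDensity B u h (BScheme.semigroup B u h t f) i
            * BScheme.stationary u h i) ∧
          BScheme.pairing (BScheme.energyDensity B u h (BScheme.semigroup B u h t f))
              (BScheme.stationary u h)
            ≤ Real.exp (-θ * t) *
              BScheme.pairing (BScheme.energyDensity B u h f) (BScheme.stationary u h) := by
  obtain ⟨κ, hκ, hcurv⟩ := BScheme.exists_curvature_bound hB hBconv hu hlam hconv
  refine ⟨2 * κ, by positivity, fun h hh => ?_⟩
  have H := BScheme.isCurvedChain hB hu hlam hconv hh (hcurv h hh)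
  have hw := BScheme.summable_gibbsWeight hu hlam hconv hh
  have hwa := BScheme.summable_gibbsWeight_mul_rateUp hB hu hlam hconv hh
  have hw0 := fun i => (H.weight_pos i).le
  have hwa0 := fun i => mul_nonneg (hw0 i) (H.up_pos i).le
  refine ⟨hw, fun f ⟨C, hf⟩ => ?_⟩
  have hsf := BScheme.hasSum_energyDensity hB hh hw hwa hf
  refine ⟨hsf.summable, fun t ht => ?_⟩
  have hP : BScheme.semigroup B u h t f
      = BScheme.chainSemigroup (BScheme.rateUp B u h) (BScheme.rateDown B u h) f t := rfl
  have hPC : ∀ i, |BScheme.semigroup B u h t f i| ≤ C := fun i => by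
    rw [hP]
    exact BScheme.abs_chainSemigroup_le (fun i => (H.up_pos i).le) (fun i => (H.down_pos i).le)
      hf ht i
  have hsP := BScheme.hasSum_energyDensity hB hh hw hwa hPC
  refine ⟨hsP.summable, ?_⟩
  rw [BScheme.pairing, BScheme.pairing, hsP.tsum_eq, hsf.tsum_eq, ← mul_div_assoc]
  refine div_le_div_of_nonneg_right ?_ (tsum_nonneg hw0)
  set c := BScheme.pairing f (BScheme.stationary u h) with hc
  have hsplit : ∀ g : ℤ → ℝ, (∀ i, |g i| ≤ C) →
      ∑' i, (BScheme.gibbsWeight u h i * (g i - c) ^ 2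
          + BScheme.gibbsWeight u h i * BScheme.rateUp B u h i * (g (i + 1) - g i) ^ 2)
        = ∑' i, BScheme.gibbsWeight u h i * (g i - c) ^ 2
          + ∑' i, BScheme.gibbsWeight u h i * BScheme.rateUp B u h i * (g (i + 1) - g i) ^ 2 :=
    fun g hg => (BScheme.summable_mul_of_bounded hw0 hw
      fun i => BScheme.abs_sub_sq_le (hg i) le_rfl).tsum_add
      (BScheme.summable_mul_of_bounded hwa0 hwa
        fun i => BScheme.abs_sub_sq_le (hg (i + 1)) (hg i))
  have hdecay := H.energy_decay hκ hw hwa hf ht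
    (hc.trans (BScheme.pairing_stationary u h f))
  rw [← hP, hsplit _ hPC, hsplit f hf] at hdecay
  -- The mean of `P_t f` may be replaced by that of `f`: this does not decrease the left side.
  have hmean := BScheme.tsum_sub_mean_sq_le H.weight_pos hw hPC c
  rw [← BScheme.pairing_stationary] at hmean
  linarith
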